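/- Let $(M,\omega)$ be a symplectic manifold of dimension $2n+2$ (smooth, Hausdorff, second countable, without boundary), $H:M\to\mathbb R$ a smooth function, and $X_H$ its Hamiltonian vector field, $i_{X_H}\omega=-dH$. Let $\mathbf D$ be a smooth vector field on $M$ with $L_{\mathbf D}\omega=\omega$ and $L_{\mathbf D}H=\Lambda H$ for some $\Lambda\in\mathbb R$. Suppose that $\mathbf D$ is complete, that its flow acts freely and properly on $M$, and let $\pi:M\to C=M/\mathbf D$ be the smooth quotient manifold (of dimension $2n+1$; $\pi$ is a surjective submersion whose fibres are the orbits of $\mathbf D$). Put $\lambda=i_{\mathbf D}\omega$ and $\mathscr D=\pi_*(\ker\lambda)\subset TC$. At $c=\pi(m)$, let $[\omega]$ be the conformal symplectic structure on $\mathscr D_c$ represented by $(\pi_*\tilde u_1,\pi_*\tilde u_2)\mapsto\omega_m(\tilde u_1,\tilde u_2)$ for $\tilde u_1,\tilde u_2\in\ker\lambda_m$; up to a positive factor it does not depend on the choice of $m$ over $c$ and of the lifts. Let $^\perp$ denote the fibrewise orthogonal complement in $\mathscr D$ for this structure. Then: 1. $\ell:=\pi_*\,\mathrm{span}(X_H)$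 is a well-defined smooth line field on $C$ (possibly with zeros): $\ell_{\pi(m)}=d\pi_m(\mathrm{span}\,X_H(m))$ for every $m\in M$, locally $\ell$ is the span of a smooth vector field, and $\ell_{\pi(m)}=0$ exactly when $X_H(m)\in\mathrm{span}\,\mathbf D(m)$. 2. The integral curves of $\ell$ are the projections to $C$ of the orbits of $X_H$, up to reparametrization: call a $C^1$ curve $\gamma:I\to C$ on an open interval an integral curve of $\ell$ if $\gamma'(t)\in\ell_{\gamma(t)}$ for all $t\in I$ and $\gamma$ is either immersed or constant at a zero of $\ell$. Then $\gamma$ is an integral curve of $\ell$ if and only if $\gamma=\pi\circ x\circ\tau$ for some $C^1$ function $\tau:I\to\mathbb R$ with nowhere vanishing derivative and some integral curve $x:\tau(I)\to M$ of $X_H$. 3. Let $\Sigma_0=\pi(\{H=0\})$. At every point $c=\pi(m)$ of $\Sigma_0$ with $H(m)=0$ and $dH_m\neq0$ (near which $\Sigma_0$ is a smooth hypersurface), $$\ell_c=(T_c\Sigma_0\cap\mathscr D_c)^\perp\subset T_c\Sigma_0\cap\mathscr D_c .$$ -/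

import Mathlib

open scoped Manifold ContDiff Topology

noncomputable section

/-! ### Symplectic manifolds and Hamiltonian systems -/

section Symplectic

variable {E : Type*} [NormedAddCommGroup E] [NormedSpace ℝ E]
  {M : Type*} [TopologicalSpace M] [ChartedSpace E M]

/-- The expression of a `2`-form on `M` in the preferred chart at `x`, i.e. its pullback under the
inverse of that chart. It is meaningful on the target of the chart. -/
def formInChart (Ω : ∀ m : M, TangentSpace 𝓘(ℝ, E) m [⋀^Fin 2]→L[ℝ] ℝ) (x : M) :
    E → E [⋀^Fin 2]→L[ℝ] ℝ :=
  fun y => (Ω ((extChartAt 𝓘(ℝ, E) x).symm y)).compContinuousLinearMap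
    (mfderiv 𝓘(ℝ, E) 𝓘(ℝ, E) (extChartAt 𝓘(ℝ, E) x).symm y)

variable (E M) in
/-- A symplectic form: a smooth, closed, non-degenerate `2`-form. -/
structure SymplecticForm where
  /-- the underlying field of alternating bilinear forms -/
  form : ∀ m : M, TangentSpace 𝓘(ℝ, E) m [⋀^Fin 2]→L[ℝ] ℝ
  smooth : ∀ x : M, ContDiffOn ℝ ∞ (formInChart form x) (extChartAt 𝓘(ℝ, E) x).target
  closed : ∀ x : M, ∀ y ∈ (extChartAt 𝓘(ℝ, E) x).target, extDeriv (formInChart form x) y = 0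
  nondegenerate : ∀ (m : M) (u : TangentSpace 𝓘(ℝ, E) m), (∀ v, form m ![u, v] = 0) → u = 0

/-- In finite dimension, every linear functional on a tangent space is `i_u Ω` for some `u`. -/
theorem SymplecticForm.exists_contraction_eq [FiniteDimensional ℝ E] (Ω : SymplecticForm E M)
    (m : M) (f : TangentSpace 𝓘(ℝ, E) m →L[ℝ] ℝ) :
    ∃ u : TangentSpace 𝓘(ℝ, E) m, ∀ v, Ω.form m ![u, v] = f v := by
  have h0 (u v w : TangentSpace 𝓘(ℝ, E) m) : ![w, v] = Function.update ![u, v] 0 w := by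
    funext i; fin_cases i <;> simp
  have h1 (u v w : TangentSpace 𝓘(ℝ, E) m) : ![u, w] = Function.update ![u, v] 1 w := by
    funext i; fin_cases i <;> simp
  let B : TangentSpace 𝓘(ℝ, E) m →ₗ[ℝ] TangentSpace 𝓘(ℝ, E) m →ₗ[ℝ] ℝ :=
    LinearMap.mk₂ ℝ (fun u v => Ω.form m ![u, v])
      (fun u u' v => by
        rw [h0 0, h0 0 v u, h0 0 v u']; exact (Ω.form m).map_update_add _ _ _ _)
      (fun c u v => by
        rw [h0 0, h0 0 v u]; exact (Ω.form m).map_update_smul _ _ _ _)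
      (fun u v v' => by
        rw [h1 u 0, h1 u 0 v, h1 u 0 v']; exact (Ω.form m).map_update_add _ _ _ _)
      (fun c u v => by
        rw [h1 u 0, h1 u 0 v]; exact (Ω.form m).map_update_smul _ _ _ _)
  have hinj : Function.Injective B := by
    rw [← LinearMap.ker_eq_bot, LinearMap.ker_eq_bot']
    intro u hu
    exact Ω.nondegenerate m u fun v => by
      have := LinearMap.congr_fun hu v
      simpa [B] using this
  have hsurj : Function.Surjective B :=
    (LinearMap.injective_iff_surjective_of_finrank_eq_finrank
      (Subspace.dual_finrank_eq (K := ℝ) (V := E)).symm).1 hinj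
  obtain ⟨u, hu⟩ := hsurj (f : E →L[ℝ] ℝ).toLinearMap
  exact ⟨u, fun v => LinearMap.congr_fun hu v⟩

/-- The Hamiltonian vector field `X_H`, determined by `i_{X_H} Ω = - dH`. -/
def hamiltonianVectorField [FiniteDimensional ℝ E] (Ω : SymplecticForm E M) (H : M → ℝ) (m : M) :
    TangentSpace 𝓘(ℝ, E) m :=
  Classical.choose (Ω.exists_contraction_eq m (-(mfderiv 𝓘(ℝ, E) 𝓘(ℝ, ℝ) H m : E →L[ℝ] ℝ)))

theorem hamiltonianVectorField_spec [FiniteDimensional ℝ E] (Ω : SymplecticForm E M) (H : M → ℝ)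
    (m : M) (v : TangentSpace 𝓘(ℝ, E) m) :
    Ω.form m ![hamiltonianVectorField Ω H m, v]
      = -(mfderiv 𝓘(ℝ, E) 𝓘(ℝ, ℝ) H m v : ℝ) :=
  Classical.choose_spec (Ω.exists_contraction_eq m
    (-(mfderiv 𝓘(ℝ, E) 𝓘(ℝ, ℝ) H m : E →L[ℝ] ℝ))) v

/-! ### Complete flows and scaling symmetries -/

/-- `φ` is the (global) flow of the complete vector field `D`: a smooth action of `ℝ` on `M` whose
orbit maps are integral curves of `D`. -/
structure IsGlobalFlow (D : ∀ m : M, TangentSpace 𝓘(ℝ, E) m) (φ : ℝ → M → M) : Prop where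
  smooth : ContMDiff (𝓘(ℝ, ℝ).prod 𝓘(ℝ, E)) 𝓘(ℝ, E) ∞ (fun p : ℝ × M => φ p.1 p.2)
  zero : ∀ m, φ 0 m = m
  add : ∀ s t m, φ (s + t) m = φ s (φ t m)
  integralCurve : ∀ m, IsMIntegralCurve (I := 𝓘(ℝ, E)) (fun t => φ t m) D

/-- The vector field with flow `φ`, say `D`, is a scaling symmetry of degree `Λ` of `(M, Ω, H)`:
`L_D Ω = Ω` and `L_D H = Λ H`, where the Lie derivatives are the derivatives at time `0` of the
pullbacks under the flow. -/
structure IsScalingSymmetry (Ω : SymplecticForm E M) (H : M → ℝ) (φ : ℝ → M → M) (Λ : ℝ) :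
    Prop where
  form : ∀ (m : M) (u v : TangentSpace 𝓘(ℝ, E) m),
    HasDerivAt (fun t : ℝ => Ω.form (φ t m)
      ![mfderiv 𝓘(ℝ, E) 𝓘(ℝ, E) (φ t) m u, mfderiv 𝓘(ℝ, E) 𝓘(ℝ, E) (φ t) m v])
      (Ω.form m ![u, v]) 0
  hamiltonian : ∀ m : M, HasDerivAt (fun t : ℝ => H (φ t m)) (Λ * H m) 0

/-- The action `φ` of `ℝ` is free and proper. -/
structure IsFreeProper (φ : ℝ → M → M) : Prop where
  free : ∀ t m, φ t m = m → t = 0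
  proper : IsProperMap (fun p : ℝ × M => (φ p.1 p.2, p.2))

end Symplectic

/-! ### The quotient and the induced structures on it

Distributions (of possibly varying rank) on a manifold are treated as subsets of its tangent
bundle. -/

section Quotient

variable {E : Type*} [NormedAddCommGroup E] [NormedSpace ℝ E]
  {M : Type*} [TopologicalSpace M] [ChartedSpace E M]
  {E' : Type*} [NormedAddCommGroup E'] [NormedSpace ℝ E']
  {C : Type*} [TopologicalSpace C] [ChartedSpace E' C]

/-- `π : M → C` exhibits the manifold `C` as the quotient of `M` by the action `φ`: it is a
surjective smooth submersion whose fibres are exactly the orbits. -/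
structure IsQuotientByFlow (E E' : Type*) [NormedAddCommGroup E] [NormedSpace ℝ E]
    [NormedAddCommGroup E'] [NormedSpace ℝ E']
    {M : Type*} [TopologicalSpace M] [ChartedSpace E M]
    {C : Type*} [TopologicalSpace C] [ChartedSpace E' C]
    (φ : ℝ → M → M) (π : M → C) : Prop where
  surjective : Function.Surjective π
  submersion : Manifold.IsSubmersion 𝓘(ℝ, E) 𝓘(ℝ, E') ∞ π
  fibre : ∀ m m', π m = π m' ↔ ∃ t, φ t m = m'

/-- The fibre over `c` of a subset of the tangent bundle. -/
def tangentFibre (S : Set (TangentBundle 𝓘(ℝ, E') C)) (c : C) : Set (TangentSpace 𝓘(ℝ, E') c) :=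
  {v | (⟨c, v⟩ : TangentBundle 𝓘(ℝ, E') C) ∈ S}

/-- `span (X)`, as a subset of the tangent bundle. -/
def spanField (X : ∀ m : M, TangentSpace 𝓘(ℝ, E) m) : Set (TangentBundle 𝓘(ℝ, E) M) :=
  {p | p.2 ∈ Submodule.span ℝ {X p.1}}

/-- `ker (i_D Ω)`, as a subset of the tangent bundle. -/
def liouvilleKernel (Ω : SymplecticForm E M) (D : ∀ m : M, TangentSpace 𝓘(ℝ, E) m) :
    Set (TangentBundle 𝓘(ℝ, E) M) :=
  {p | Ω.form p.1 ![D p.1, p.2] = 0}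

/-- The push-forward `π_* S` of a subset `S` of the tangent bundle of `M`. -/
def pushforward (π : M → C) (S : Set (TangentBundle 𝓘(ℝ, E) M)) :
    Set (TangentBundle 𝓘(ℝ, E') C) :=
  tangentMap 𝓘(ℝ, E) 𝓘(ℝ, E') π '' S

/-- The line field `ℓ = π_* span (X_H)` on the quotient. -/
def reducedLineField (E' : Type*) [NormedAddCommGroup E'] [NormedSpace ℝ E']
    {C : Type*} [TopologicalSpace C] [ChartedSpace E' C] [FiniteDimensional ℝ E] (Ω : SymplecticForm E M) (H : M → ℝ) (π : M → C) :
    Set (TangentBundle 𝓘(ℝ, E') C) :=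
  pushforward π (spanField (hamiltonianVectorField Ω H))

/-- The contact distribution `𝒟 = π_* ker (i_D Ω)` on the quotient. -/
def contactDistribution (Ω : SymplecticForm E M) (D : ∀ m : M, TangentSpace 𝓘(ℝ, E) m)
    (π : M → C) : Set (TangentBundle 𝓘(ℝ, E') C) :=
  pushforward π (liouvilleKernel Ω D)

/-- Orthogonality for the conformal symplectic structure on `𝒟`, which is represented at `c` by
`(π_* u, π_* v) ↦ Ω_m (u, v)`, where `π m = c` and `u`, `v` lie in the kernel of `i_D Ω` at `m`. -/
def ConformalOrthogonal (Ω : SymplecticForm E M) (D : ∀ m : M, TangentSpace 𝓘(ℝ, E) m)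
    (π : M → C) (p q : TangentBundle 𝓘(ℝ, E') C) : Prop :=
  ∃ (m : M) (u v : TangentSpace 𝓘(ℝ, E) m),
    (⟨m, u⟩ : TangentBundle 𝓘(ℝ, E) M) ∈ liouvilleKernel Ω D ∧
    (⟨m, v⟩ : TangentBundle 𝓘(ℝ, E) M) ∈ liouvilleKernel Ω D ∧
    tangentMap 𝓘(ℝ, E) 𝓘(ℝ, E') π ⟨m, u⟩ = p ∧ tangentMap 𝓘(ℝ, E) 𝓘(ℝ, E') π ⟨m, v⟩ = q ∧
    Ω.form m ![u, v] = 0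

/-- The fibrewise orthogonal complement in `𝒟` of a subset of `𝒟`, for the conformal symplectic
structure. -/
def conformalPerp (Ω : SymplecticForm E M) (D : ∀ m : M, TangentSpace 𝓘(ℝ, E) m)
    (π : M → C) (S : Set (TangentBundle 𝓘(ℝ, E') C)) : Set (TangentBundle 𝓘(ℝ, E') C) :=
  {p | p ∈ contactDistribution Ω D π ∧
    ∀ q ∈ S, q.proj = p.proj → ConformalOrthogonal Ω D π p q}

/-- The image `Σ₀` of the zero level of `H`. -/
def zeroLevelImage (H : M → ℝ) (π : M → C) : Set C := π '' {m | H m = 0}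

/-- The tangent vectors to a subset `S` of a manifold: velocities at time `0` of `C¹` curves that
lie in `S` (for an embedded submanifold these form its tangent bundle). -/
def tangentVectors (E' : Type*) [NormedAddCommGroup E'] [NormedSpace ℝ E']
    {C : Type*} [TopologicalSpace C] [ChartedSpace E' C] (S : Set C) :
    Set (TangentBundle 𝓘(ℝ, E') C) :=
  {p | ∃ γ : ℝ → C, ContMDiffAt 𝓘(ℝ, ℝ) 𝓘(ℝ, E') 1 γ 0 ∧ (∀ᶠ t in 𝓝 (0 : ℝ), γ t ∈ S) ∧
    p = ⟨γ 0, mfderiv 𝓘(ℝ, ℝ) 𝓘(ℝ, E') γ 0 (1 : ℝ)⟩}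

/-! ### Line fields and their integral curves -/

/-- A smooth line field, possibly with zeros: locally it is the span of a smooth vector field. -/
def IsSmoothLineField [IsManifold 𝓘(ℝ, E') 1 C]
    (ℓ : Set (TangentBundle 𝓘(ℝ, E') C)) : Prop :=
  ∀ c : C, ∃ U : Set C, IsOpen U ∧ c ∈ U ∧ ∃ Y : ∀ c : C, TangentSpace 𝓘(ℝ, E') c,
    ContMDiffOn 𝓘(ℝ, E') 𝓘(ℝ, E').tangent ∞
      (fun c => (⟨c, Y c⟩ : TangentBundle 𝓘(ℝ, E') C)) U ∧
    ∀ c' ∈ U, tangentFibre ℓ c' = (Submodule.span ℝ {Y c'} : Set (TangentSpace 𝓘(ℝ, E') c'))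

/-- `γ` is an integral curve of the line field `ℓ` on the open interval `s`: a `C¹` curve tangent
to `ℓ` that is either immersed or stationary at a zero of `ℓ`. (A line field does not
determine a parametrization, so none is prescribed.) -/
def IsLineFieldIntegralCurve (ℓ : Set (TangentBundle 𝓘(ℝ, E') C)) (γ : ℝ → C) (s : Set ℝ) :
    Prop :=
  ContMDiffOn 𝓘(ℝ, ℝ) 𝓘(ℝ, E') 1 γ s ∧
  (∀ t ∈ s, mfderiv 𝓘(ℝ, ℝ) 𝓘(ℝ, E') γ t (1 : ℝ) ∈ tangentFibre ℓ (γ t)) ∧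
  ((∀ t ∈ s, mfderiv 𝓘(ℝ, ℝ) 𝓘(ℝ, E') γ t (1 : ℝ) ≠ 0) ∨
    ∃ c : C, tangentFibre ℓ c = {0} ∧ ∀ t ∈ s, γ t = c)

end Quotient

end

/-! Integrating the infinitesimal scaling laws along the flow gives `φ_t^* Ω = e^t Ω` and `H ∘ φ_t =
e^{Λt} H`. Non-degeneracy then forces `dφ_t X_H = e^{(1-Λ)t} X_H ∘ φ_t`
(`IsScalingSymmetry.hamiltonianField_flow`). So the line spanned by `X_H`, though not `X_H` itself,
is invariant. By rank-nullity, `ker dπ` is spanned by `D`, which has no zeros because the action is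
free. Hence the projected line does not depend on the point of the fibre, and it vanishes exactly
when `X_H` is a multiple of `D`.

Smoothness comes from a global section `σ` of `π`: the local time functions along the flow can be
averaged by a partition of unity on `C`, because `h ∘ φ_t = h + t` is an affine condition. The field
`Y = dπ (X_H ∘ σ)` then spans `ℓ` on all of `C`.

For an immersed integral curve write `γ' = f Y(γ)`. Lifts have the form `φ_A (σ ∘ γ)`, and one
quadrature for `A` cancels the `D`-component of the velocity. The lift then follows `X_H` up to a
second quadrature, which is the change of time (`exists_trajectory_of_immersed`). Over a zero of
`ℓ`, `X_H` is tangent to the orbit of `D`, and a scalar equation yields a trajectory inside it.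
Conversely, uniqueness for the equation of `X_H` keeps a trajectory that meets such an orbit inside
that orbit, so its projection is either immersed or constant.

On `H = 0` one has `Ω(D, X_H) = dH(D) = ΛH = 0`, so `X_H` lies in `ker λ`. Both `D` and `X_H` are
orthogonal to `ker λ ∩ ker dH`, which projects onto `TΣ₀ ∩ 𝒟`. By linear duality the orthogonal
complement of this intersection is the span of `D` and `X_H`, and `dπ` maps that span onto `ℓ`
(`exists_eq_add_of_pairing`, `mem_conformalPerp_iff`). -/

noncomputable section

set_option linter.unusedSectionVars false

/-! ### Local inverses and local sections -/

section InverseFunction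

variable {E : Type*} [NormedAddCommGroup E] [NormedSpace ℝ E] [CompleteSpace E]
  {H : Type*} [TopologicalSpace H] {I : ModelWithCorners ℝ E H} [I.Boundaryless]
  {N : Type*} [TopologicalSpace N] [ChartedSpace H N]
  {E' : Type*} [NormedAddCommGroup E'] [NormedSpace ℝ E'] [CompleteSpace E']
  {H' : Type*} [TopologicalSpace H'] {J : ModelWithCorners ℝ E' H'}
  {M : Type*} [TopologicalSpace M] [ChartedSpace H' M]

/-- The inverse function theorem on boundaryless manifolds: a local right inverse. -/
theorem ContMDiffAt.exists_rightInverse {n : ℕ∞ω} (hn : n ≠ 0) [IsManifold I n N]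
    [IsManifold J n M] {G : N → M} {p : N} (hG : ContMDiffAt I J n G p)
    (hbij : Function.Bijective (mfderiv I J G p)) :
    ∃ θ : M → N, ContMDiffAt J I n θ (G p) ∧ θ (G p) = p ∧ ∀ᶠ m in 𝓝 (G p), G (θ m) = m := by
  have hG' := (contMDiffAt_iff.1 hG).2
  rw [I.range_eq_univ, contDiffWithinAt_univ] at hG'
  set g : E → E' := extChartAt J (G p) ∘ G ∘ (extChartAt I p).symm with hg
  have hd : mfderiv I J G p = fderiv ℝ g (extChartAt I p p) := by
    have h1 := (hG.mdifferentiableAt hn).mfderiv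
    rw [I.range_eq_univ, fderivWithin_univ] at h1
    exact h1
  rw [hd] at hbij
  let f' : E ≃L[ℝ] E' := ContinuousLinearEquiv.ofBijective (fderiv ℝ g (extChartAt I p p))
    (LinearMap.ker_eq_bot.2 hbij.1) (LinearMap.range_eq_top.2 hbij.2)
  have hf' : HasFDerivAt g (f' : E →L[ℝ] E') (extChartAt I p p) := by
    have : (f' : E →L[ℝ] E') = fderiv ℝ g (extChartAt I p p) := by ext; rfl
    rw [this]
    exact (hG'.differentiableAt hn).hasFDerivAt
  have hga : g (extChartAt I p p) = extChartAt J (G p) (G p) := by simp [hg]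
  have hL : ContDiffAt ℝ n (hG'.localInverse hf' hn) (g (extChartAt I p p)) :=
    hG'.to_localInverse hf' hn
  have hL0 : hG'.localInverse hf' hn (g (extChartAt I p p)) = extChartAt I p p :=
    hG'.localInverse_apply_image hf' hn
  have hR := (hG'.hasStrictFDerivAt' hf' hn).eventually_right_inverse
  set L := hG'.localInverse hf' hn with hLdef
  have hR : ∀ᶠ y in 𝓝 (g (extChartAt I p p)), g (L y) = y := hR
  rw [hga] at hL hL0 hR
  have hch : ContinuousAt (extChartAt J (G p)) (G p) := continuousAt_extChartAt _
  have hLc : ContinuousAt (L ∘ extChartAt J (G p)) (G p) := hL.continuousAt.comp hch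
  have hsymm : ContinuousAt (extChartAt I p).symm (extChartAt I p p) :=
    continuousAt_extChartAt_symm _
  refine ⟨fun m => (extChartAt I p).symm (L (extChartAt J (G p) m)), ?_, ?_, ?_⟩
  · have h1 : ContMDiffAt 𝓘(ℝ, E) I n (extChartAt I p).symm (L (extChartAt J (G p) (G p))) := by
      rw [hL0]
      have := contMDiffWithinAt_extChartAt_symm_range (I := I) (n := n) p (mem_extChartAt_target p)
      rwa [I.range_eq_univ, contMDiffWithinAt_univ] at this
    exact h1.comp (G p) (hL.contMDiffAt.comp (G p) contMDiffAt_extChartAt)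
  · simp only [hL0, extChartAt_to_inv]
  · have hθ : ContinuousAt (fun m => (extChartAt I p).symm (L (extChartAt J (G p) m))) (G p) := by
      refine ContinuousAt.comp (g := (extChartAt I p).symm)
        (f := fun m => L (extChartAt J (G p) m)) ?_ hLc
      rw [hL0]; exact hsymm
    have hθ0 : (extChartAt I p).symm (L (extChartAt J (G p) (G p))) = p := by
      simp only [hL0, extChartAt_to_inv]
    have hGθ : ContinuousAt (fun m => G ((extChartAt I p).symm (L (extChartAt J (G p) m))))
        (G p) := ContinuousAt.comp (g := G) (by rw [hθ0]; exact hG.continuousAt) hθ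
    -- The chart is injective only on its source, so `G (θ m)` has to be placed there before the
    -- chart can be cancelled.
    have e1 := hGθ.eventually_mem (by
      simp only [hL0, extChartAt_to_inv]
      exact extChartAt_source_mem_nhds (I := J) (G p))
    filter_upwards [e1, hch.eventually hR, extChartAt_source_mem_nhds (I := J) (G p)]
      with m h1 h2 h3
    exact (extChartAt J (G p)).injOn h1 h3 h2

end InverseFunction

section LocalSection

variable {E : Type*} [NormedAddCommGroup E] [NormedSpace ℝ E]
  {M : Type*} [TopologicalSpace M] [ChartedSpace E M]
  {E' : Type*} [NormedAddCommGroup E'] [NormedSpace ℝ E']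
  {C : Type*} [TopologicalSpace C] [ChartedSpace E' C]

/-- A submersion has a smooth local section through every point. -/
theorem Manifold.IsSubmersion.exists_localSection {n : ℕ∞ω} {π : M → C}
    (hπ : Manifold.IsSubmersion 𝓘(ℝ, E) 𝓘(ℝ, E') n π) (m : M) :
    ∃ (U : Set C) (σ : C → M), IsOpen U ∧ π m ∈ U ∧ ContMDiffOn 𝓘(ℝ, E') 𝓘(ℝ, E) n σ U ∧
      σ (π m) = m ∧ ∀ c ∈ U, π (σ c) = c := by
  obtain ⟨F, _, _, hF⟩ := hπ
  have h := hF m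
  have hw := h.writtenInCharts
  set e := h.domChart with he
  set k := h.codChart with hk
  set L := h.equiv
  have hme : m ∈ e.source := h.mem_domChart_source
  have hmk : π m ∈ k.source := h.mem_codChart_source
  have hex : ∀ x, e.extend 𝓘(ℝ, E) x = e x := fun x => rfl
  have hes : ∀ x, (e.extend 𝓘(ℝ, E)).symm x = e.symm x := fun x => rfl
  have hkx : ∀ x, k.extend 𝓘(ℝ, E') x = k x := fun x => rfl
  have het : (e.extend 𝓘(ℝ, E)).target = e.target := by simp
  -- In the adapted charts `π` is the projection to the first factor. Freezing the second coordinate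
  -- at its value at `m` gives a section through `m`.
  let b : F := (L (e m)).2
  let ψ : C → E := fun c => L.symm (k c, b)
  have hLm : L (e m) = (k (π m), b) := by
    have := hw (x := e m) (by rw [het]; exact e.map_source hme)
    simp only [Function.comp_apply, hes, e.left_inv hme, hkx] at this
    exact Prod.ext this.symm rfl
  have hψm : ψ (π m) = e m := by simp [ψ, ← hLm]
  have hψ : ContinuousOn ψ k.source :=
    L.symm.continuous.comp_continuousOn (k.continuousOn.prodMk continuousOn_const)
  refine ⟨k.source ∩ ψ ⁻¹' e.target, fun c => e.symm (ψ c), ?_, ?_, ?_, ?_, ?_⟩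
  · exact hψ.isOpen_inter_preimage k.open_source e.open_target
  · exact ⟨hmk, by rw [Set.mem_preimage, hψm]; exact e.map_source hme⟩
  · have h1 : ContMDiffOn 𝓘(ℝ, E') 𝓘(ℝ, E') n k k.source :=
      contMDiffOn_of_mem_maximalAtlas h.codChart_mem_maximalAtlas
    have h2 : ContMDiffOn 𝓘(ℝ, E) 𝓘(ℝ, E) n e.symm e.target :=
      contMDiffOn_symm_of_mem_maximalAtlas h.domChart_mem_maximalAtlas
    have h3 : ContMDiff 𝓘(ℝ, E') 𝓘(ℝ, E) n (fun y : E' => L.symm (y, b)) := by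
      rw [contMDiff_iff_contDiff]
      exact L.symm.contDiff.comp (contDiff_id.prodMk contDiff_const)
    exact h2.comp ((h3.comp_contMDiffOn h1).mono Set.inter_subset_left) (fun c hc => hc.2)
  · show e.symm (ψ (π m)) = m
    rw [hψm, e.left_inv hme]
  · rintro c ⟨hc, hct⟩
    have := hw (x := ψ c) (by rw [het]; exact hct)
    simp only [Function.comp_apply, hes, hkx] at this
    have h4 : k (π (e.symm (ψ c))) = k c := by rw [this]; simp [ψ]
    refine k.injOn ?_ hc h4
    exact h.source_subset_preimage_source (e.map_target hct)

end LocalSection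

/-! ### Derivatives and velocities with values in the model space -/

section Velocity

variable {E : Type*} [NormedAddCommGroup E] [NormedSpace ℝ E]
  {M : Type*} [TopologicalSpace M] [ChartedSpace E M]
  {E' : Type*} [NormedAddCommGroup E'] [NormedSpace ℝ E']
  {C : Type*} [TopologicalSpace C] [ChartedSpace E' C]
  {E'' : Type*} [NormedAddCommGroup E''] [NormedSpace ℝ E'']
  {N : Type*} [TopologicalSpace N] [ChartedSpace E'' N]

variable (E E') in
/-- The derivative of a map between manifolds, as a linear map between the model spaces. -/
def modelDeriv (f : M → C) (m : M) : E →L[ℝ] E' := mfderiv 𝓘(ℝ, E) 𝓘(ℝ, E') f m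

variable (E) in
/-- The curve `y` has velocity `v` at time `t`. -/
def HasVelocityAt (y : ℝ → M) (t : ℝ) (v : E) : Prop :=
  HasMFDerivAt 𝓘(ℝ, ℝ) 𝓘(ℝ, E) y t ((1 : ℝ →L[ℝ] ℝ).smulRight v : ℝ →L[ℝ] E)

theorem modelDeriv_comp (g : C → N) (f : M → C) (m : M)
    (hg : MDifferentiableAt 𝓘(ℝ, E') 𝓘(ℝ, E'') g (f m))
    (hf : MDifferentiableAt 𝓘(ℝ, E) 𝓘(ℝ, E') f m) (u : E) :
    modelDeriv E E'' (fun x => g (f x)) m u = modelDeriv E' E'' g (f m) (modelDeriv E E' f m u) :=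
  congrArg (fun L : E →L[ℝ] E'' => L u) (mfderiv_comp m hg hf)

theorem modelDeriv_id (m : M) (u : E) : modelDeriv E E (fun x : M => x) m u = u :=
  congrArg (fun L : E →L[ℝ] E => L u) (mfderiv_id (I := 𝓘(ℝ, E)) (x := m))

theorem modelDeriv_congr {f g : M → C} {m : M} (h : f =ᶠ[𝓝 m] g) :
    modelDeriv E E' f m = modelDeriv E E' g m :=
  h.mfderiv_eq

theorem hasMFDerivAt_iff_hasVelocityAt {y : ℝ → M} {t : ℝ} (L : ℝ →L[ℝ] E) :
    HasMFDerivAt 𝓘(ℝ, ℝ) 𝓘(ℝ, E) y t L ↔ HasVelocityAt E y t (L 1) := by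
  have h1 : (1 : ℝ →L[ℝ] ℝ).smulRight (L 1) = L := by ext; simp
  unfold HasVelocityAt
  rw [h1]

theorem HasVelocityAt.mfderiv_one {y : ℝ → M} {t : ℝ} {v : E}
    (h : HasVelocityAt E y t v) : modelDeriv ℝ E y t 1 = v := by
  have h1 : modelDeriv ℝ E y t = (1 : ℝ →L[ℝ] ℝ).smulRight v := HasMFDerivAt.mfderiv h
  rw [h1]
  simp

theorem HasVelocityAt.unique {y : ℝ → M} {t : ℝ} {v w : E}
    (h : HasVelocityAt E y t v) (h' : HasVelocityAt E y t w) : v = w :=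
  h.mfderiv_one.symm.trans h'.mfderiv_one

theorem MDifferentiableAt.hasVelocityAt {y : ℝ → M} {t : ℝ}
    (h : MDifferentiableAt 𝓘(ℝ, ℝ) 𝓘(ℝ, E) y t) :
    HasVelocityAt E y t (modelDeriv ℝ E y t 1) :=
  (hasMFDerivAt_iff_hasVelocityAt (modelDeriv ℝ E y t)).1 h.hasMFDerivAt

theorem HasVelocityAt.congr {y y' : ℝ → M} {t : ℝ} {v : E}
    (h : HasVelocityAt E y t v) (hy : y' =ᶠ[𝓝 t] y) : HasVelocityAt E y' t v :=
  HasMFDerivAt.congr_of_eventuallyEq (h : HasMFDerivAt 𝓘(ℝ, ℝ) 𝓘(ℝ, E) y t _) hy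

theorem HasVelocityAt.map {y : ℝ → M} {t : ℝ} {v : E}
    (h : HasVelocityAt E y t v) {f : M → C}
    (hf : MDifferentiableAt 𝓘(ℝ, E) 𝓘(ℝ, E') f (y t)) :
    HasVelocityAt E' (fun s => f (y s)) t (modelDeriv E E' f (y t) v) := by
  let L : ℝ →L[ℝ] E' := (modelDeriv E E' f (y t)).comp ((1 : ℝ →L[ℝ] ℝ).smulRight v)
  have h1 : HasMFDerivAt 𝓘(ℝ, ℝ) 𝓘(ℝ, E') (fun s => f (y s)) t L := hf.hasMFDerivAt.comp t h
  simpa [L] using (hasMFDerivAt_iff_hasVelocityAt L).1 h1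

theorem HasVelocityAt.comp {y : ℝ → M} {t : ℝ} {τ : ℝ → ℝ} {a : ℝ} {v : E}
    (h : HasVelocityAt E y (τ t) v) (hτ : HasDerivAt τ a t) :
    HasVelocityAt E (fun s => y (τ s)) t (a • v) := by
  let L : ℝ →L[ℝ] E :=
    ((1 : ℝ →L[ℝ] ℝ).smulRight v).comp (ContinuousLinearMap.toSpanSingleton ℝ a)
  have h1 : HasMFDerivAt 𝓘(ℝ, ℝ) 𝓘(ℝ, E) (fun s => y (τ s)) t L :=
    HasMFDerivAt.comp t h hτ.hasFDerivAt.hasMFDerivAt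
  simpa [L] using (hasMFDerivAt_iff_hasVelocityAt L).1 h1

theorem HasVelocityAt.continuousAt {y : ℝ → M} {t : ℝ} {v : E}
    (h : HasVelocityAt E y t v) : ContinuousAt y t :=
  HasMFDerivAt.continuousAt h

theorem hasVelocityAt_const (m : M) (t : ℝ) : HasVelocityAt E (fun _ => m) t (0 : E) := by
  have h : HasMFDerivAt 𝓘(ℝ, ℝ) 𝓘(ℝ, E) (fun _ : ℝ => m) t (0 : ℝ →L[ℝ] E) :=
    hasMFDerivAt_const m t
  rw [hasMFDerivAt_iff_hasVelocityAt] at h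
  simpa using h

theorem hasVelocityAt_iff_hasDerivAt {a : ℝ → E} {t : ℝ} {b : E} :
    HasVelocityAt E a t b ↔ HasDerivAt a b t := by
  have h : HasVelocityAt E a t b ↔
      HasFDerivAt a ((1 : ℝ →L[ℝ] ℝ).smulRight b : ℝ →L[ℝ] E) t := hasMFDerivAt_iff_hasFDerivAt
  rw [h, hasDerivAt_iff_hasFDerivAt]
  have : (1 : ℝ →L[ℝ] ℝ).smulRight b = ContinuousLinearMap.toSpanSingleton ℝ b := by ext; simp
  rw [this]

variable (E) in
/-- The tangent vector at `m` with coordinate vector `u`. -/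
def tangentMk (m : M) (u : E) : TangentBundle 𝓘(ℝ, E) M := ⟨m, u⟩

variable (E) in
/-- The fibre at `m` of a subset of the tangent bundle, as a subset of the model space. -/
def modelFibre (S : Set (TangentBundle 𝓘(ℝ, E) M)) (m : M) : Set E := {v | tangentMk E m v ∈ S}

/-- All tangent spaces are the same model space, so the vectors can be compared without a transport
along `m = m'`. -/
theorem tangentMk_eq_iff {m m' : M} {u v : E} :
    tangentMk E m u = tangentMk E m' v ↔ m = m' ∧ u = v := by
  constructor
  · intro h
    have h1 : m = m' := congrArg (fun p : TangentBundle 𝓘(ℝ, E) M => p.1) h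
    subst h1
    exact ⟨rfl, eq_of_heq (Bundle.TotalSpace.mk.inj h).2⟩
  · rintro ⟨rfl, rfl⟩; rfl

theorem tangentMap_tangentMk (f : M → C) (m : M) (u : E) :
    tangentMap 𝓘(ℝ, E) 𝓘(ℝ, E') f (tangentMk E m u) =
      tangentMk E' (f m) (modelDeriv E E' f m u) := rfl

end Velocity

/-! ### The symplectic form as a bilinear pairing -/

section Pairing

variable {E : Type*} [NormedAddCommGroup E] [NormedSpace ℝ E]
  {M : Type*} [TopologicalSpace M] [ChartedSpace E M]

/-- An alternating bilinear form in curried form. -/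
def ContinuousAlternatingMap.pairing (η : E [⋀^Fin 2]→L[ℝ] ℝ) : E →ₗ[ℝ] E →ₗ[ℝ] ℝ :=
  have h0 (u v w : E) : ![w, v] = Function.update ![u, v] 0 w := by
    funext i; fin_cases i <;> simp
  have h1 (u v w : E) : ![u, w] = Function.update ![u, v] 1 w := by
    funext i; fin_cases i <;> simp
  LinearMap.mk₂ ℝ (fun u v : E => η ![u, v])
    (fun u u' v => by
      rw [h0 0, h0 0 v u, h0 0 v u']; exact η.map_update_add _ _ _ _)
    (fun c u v => by
      rw [h0 0, h0 0 v u]; exact η.map_update_smul _ _ _ _)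
    (fun u v v' => by
      rw [h1 u 0, h1 u 0 v, h1 u 0 v']; exact η.map_update_add _ _ _ _)
    (fun c u v => by
      rw [h1 u 0, h1 u 0 v]; exact η.map_update_smul _ _ _ _)

namespace SymplecticForm

/-- The symplectic form at a point, as a bilinear map on the model space. -/
def pairing (Ω : SymplecticForm E M) (m : M) : E →ₗ[ℝ] E →ₗ[ℝ] ℝ :=
  ContinuousAlternatingMap.pairing (E := E) (Ω.form m)

variable (Ω : SymplecticForm E M)

theorem pairing_self (m : M) (u : E) : Ω.pairing m u u = 0 :=
  let η : E [⋀^Fin 2]→L[ℝ] ℝ := Ω.form m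
  η.map_eq_zero_of_eq ![u, u] (i := 0) (j := 1) rfl (by decide)

theorem pairing_swap (m : M) (u v : E) : Ω.pairing m u v = -Ω.pairing m v u := by
  have h := Ω.pairing_self m (u + v)
  simp only [map_add, LinearMap.add_apply, pairing_self] at h
  linarith

theorem eq_zero_of_pairing (m : M) (u : E) (h : ∀ v, Ω.pairing m u v = 0) : u = 0 :=
  Ω.nondegenerate m u h

/-- The Hamiltonian vector field, with values in the model space. -/
def hamiltonian [FiniteDimensional ℝ E] (H : M → ℝ) (m : M) : E := hamiltonianVectorField Ω H m

theorem pairing_hamiltonian [FiniteDimensional ℝ E] (H : M → ℝ) (m : M) (v : E) :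
    Ω.pairing m (Ω.hamiltonian H m) v = -modelDeriv E ℝ H m v :=
  hamiltonianVectorField_spec Ω H m v

end SymplecticForm

end Pairing

/-- The product `e^{-kt} q(t)` has zero derivative. -/
theorem eq_exp_mul_of_hasDerivAt {q : ℝ → ℝ} {k : ℝ} (h : ∀ t, HasDerivAt q (k * q t) t) (t : ℝ) :
    q t = Real.exp (k * t) * q 0 := by
  have h1 : ∀ t, HasDerivAt (fun t => Real.exp (-k * t) * q t) 0 t := fun t => by
    have h2 : HasDerivAt (fun t => -k * t) (-k) t := by
      simpa using (hasDerivAt_id t).const_mul (-k)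
    refine (h2.exp.mul (h t)).congr_deriv ?_
    ring
  have h3 := is_const_of_deriv_eq_zero (fun t => (h1 t).differentiableAt)
    (fun t => (h1 t).deriv) t 0
  simp only [mul_zero, Real.exp_zero, one_mul] at h3
  rw [← h3, ← mul_assoc, ← Real.exp_add]
  simp

/-! ### The flow and its derivative -/

section Flow

variable {E : Type*} [NormedAddCommGroup E] [NormedSpace ℝ E]
  {M : Type*} [TopologicalSpace M] [ChartedSpace E M]
  {D : M → E} {φ : ℝ → M → M}

namespace IsGlobalFlow

theorem contMDiff_apply (hφ : IsGlobalFlow D φ) (t : ℝ) :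
    ContMDiff 𝓘(ℝ, E) 𝓘(ℝ, E) ∞ (φ t) :=
  hφ.smooth.comp (contMDiff_const.prodMk contMDiff_id)

theorem mdifferentiableAt_apply (hφ : IsGlobalFlow D φ) (t : ℝ) (m : M) :
    MDifferentiableAt 𝓘(ℝ, E) 𝓘(ℝ, E) (φ t) m :=
  (hφ.contMDiff_apply t).mdifferentiable (by simp) m

theorem neg_apply (hφ : IsGlobalFlow D φ) (t : ℝ) (m : M) : φ (-t) (φ t m) = m := by
  rw [← hφ.add, neg_add_cancel, hφ.zero]

theorem apply_neg (hφ : IsGlobalFlow D φ) (t : ℝ) (m : M) : φ t (φ (-t) m) = m := by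
  rw [← hφ.add, add_neg_cancel, hφ.zero]

theorem modelDeriv_add (hφ : IsGlobalFlow D φ) (s t : ℝ) (m : M) (u : E) :
    modelDeriv E E (φ (s + t)) m u =
      modelDeriv E E (φ s) (φ t m) (modelDeriv E E (φ t) m u) := by
  have h : φ (s + t) = fun m => φ s (φ t m) := funext fun m => hφ.add s t m
  rw [h, modelDeriv_comp _ _ _ (hφ.mdifferentiableAt_apply s (φ t m))
    (hφ.mdifferentiableAt_apply t m)]

theorem modelDeriv_zero (hφ : IsGlobalFlow D φ) (m : M) (u : E) :
    modelDeriv E E (φ 0) m u = u := by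
  have h : φ 0 = fun x => x := funext fun m => hφ.zero m
  rw [h, modelDeriv_id]

theorem exists_modelDeriv_eq (hφ : IsGlobalFlow D φ) (t : ℝ) (m : M) (v : E) :
    ∃ u : E, modelDeriv E E (φ t) m u = v := by
  refine ⟨modelDeriv E E (φ (-t)) (φ t m) v, ?_⟩
  have h := hφ.modelDeriv_add t (-t) (φ t m) v
  rw [hφ.neg_apply, add_neg_cancel, hφ.modelDeriv_zero] at h
  exact h.symm

theorem hasVelocityAt (hφ : IsGlobalFlow D φ) (t : ℝ) (m : M) :
    HasVelocityAt E (fun s => φ s m) t (D (φ t m)) :=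
  hφ.integralCurve m t

/-- Both sides are the velocity at `s = 0` of `φ_{s+t} m = φ_t (φ_s m)`. -/
theorem modelDeriv_generator (hφ : IsGlobalFlow D φ) (t : ℝ) (m : M) :
    modelDeriv E E (φ t) m (D m) = D (φ t m) := by
  have h1 := (hφ.hasVelocityAt 0 m).map (hφ.mdifferentiableAt_apply t (φ 0 m))
  have h3 := HasVelocityAt.comp (y := fun s => φ s m) (τ := fun s => s + t) (t := 0)
    (hφ.hasVelocityAt (0 + t) m) (by simpa using (hasDerivAt_id (0 : ℝ)).add_const t)
  have h4 : (fun s => φ (s + t) m) = fun s => φ t (φ s m) := by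
    funext s; rw [add_comm, hφ.add]
  rw [h4] at h3
  simpa [hφ.zero] using h1.unique h3

/-- The derivative of the action splits into its time and space partials. A suitable time function
`a` can thus adjust the `D`-component of a moving point. -/
theorem hasVelocityAt_comp (hφ : IsGlobalFlow D φ) {a : ℝ → ℝ} {y : ℝ → M} {t a' : ℝ}
    {v : E} (ha : HasDerivAt a a' t) (hy : HasVelocityAt E y t v) :
    HasVelocityAt E (fun s => φ (a s) (y s)) t
      (a' • D (φ (a t) (y t)) + modelDeriv E E (φ (a t)) (y t) v) := by
  have hd : MDifferentiableAt (𝓘(ℝ, ℝ).prod 𝓘(ℝ, E)) 𝓘(ℝ, E) (fun p : ℝ × M => φ p.1 p.2)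
      (a t, y t) := hφ.smooth.mdifferentiable (by simp) _
  have h1 : HasMFDerivAt 𝓘(ℝ, ℝ) (𝓘(ℝ, ℝ).prod 𝓘(ℝ, E)) (fun s => (a s, y s)) t
      ((ContinuousLinearMap.toSpanSingleton ℝ a').prod ((1 : ℝ →L[ℝ] ℝ).smulRight v) :
        ℝ →L[ℝ] ℝ × E) :=
    HasMFDerivAt.prodMk (ha.hasFDerivAt.hasMFDerivAt) hy
  let L : ℝ × E →L[ℝ] E := mfderiv (𝓘(ℝ, ℝ).prod 𝓘(ℝ, E)) 𝓘(ℝ, E) (fun p : ℝ × M => φ p.1 p.2)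
      (a t, y t)
  let A : ℝ →L[ℝ] E :=
    L.comp ((ContinuousLinearMap.toSpanSingleton ℝ a').prod ((1 : ℝ →L[ℝ] ℝ).smulRight v))
  have h2 : HasMFDerivAt 𝓘(ℝ, ℝ) 𝓘(ℝ, E) (fun s => φ (a s) (y s)) t A :=
    hd.hasMFDerivAt.comp t h1
  have hL : ∀ (b : ℝ) (w : E), L (b, w) = modelDeriv ℝ E (fun s => φ s (y t)) (a t) b +
      modelDeriv E E (φ (a t)) (y t) w := fun b w => mfderiv_prod_eq_add_apply hd (v := (b, w))
  have h2 := (hasMFDerivAt_iff_hasVelocityAt A).1 h2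
  have h3 := (hφ.hasVelocityAt (a t) (y t)).mfderiv_one
  have h4 : modelDeriv ℝ E (fun s => φ s (y t)) (a t) a' = a' • D (φ (a t) (y t)) := by
    rw [← h3, ← map_smul]
    simp
  simpa [A, hL, h4] using h2

end IsGlobalFlow

end Flow

/-! ### Scaling laws at finite time -/

section Scaling

variable {E : Type*} [NormedAddCommGroup E] [NormedSpace ℝ E]
  {M : Type*} [TopologicalSpace M] [ChartedSpace E M]
  {D : M → E} {φ : ℝ → M → M} {Ω : SymplecticForm E M} {H : M → ℝ} {Λ : ℝ}

namespace IsScalingSymmetry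

/-- The Lie derivative is given only at time `0`. The group law moves it to every time and turns it
into the equation `q' = q`. -/
theorem pairing_flow (hs : IsScalingSymmetry Ω H φ Λ) (hφ : IsGlobalFlow D φ) (t : ℝ) (m : M)
    (u v : E) : Ω.pairing (φ t m) (modelDeriv E E (φ t) m u) (modelDeriv E E (φ t) m v) =
      Real.exp t * Ω.pairing m u v := by
  set q : ℝ → ℝ := fun t =>
    Ω.pairing (φ t m) (modelDeriv E E (φ t) m u) (modelDeriv E E (φ t) m v) with hq
  have h : ∀ t, HasDerivAt q (1 * q t) t := by
    intro t
    have h1 : HasDerivAt (fun s : ℝ => Ω.pairing (φ s (φ t m))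
        (modelDeriv E E (φ s) (φ t m) (modelDeriv E E (φ t) m u))
        (modelDeriv E E (φ s) (φ t m) (modelDeriv E E (φ t) m v))) (q t) 0 :=
      hs.form (φ t m) (modelDeriv E E (φ t) m u) (modelDeriv E E (φ t) m v)
    have h2 : q = fun r => Ω.pairing (φ (r - t) (φ t m))
        (modelDeriv E E (φ (r - t)) (φ t m) (modelDeriv E E (φ t) m u))
        (modelDeriv E E (φ (r - t)) (φ t m) (modelDeriv E E (φ t) m v)) := by
      funext r
      rw [← hφ.modelDeriv_add, ← hφ.modelDeriv_add, ← hφ.add, sub_add_cancel]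
    rw [one_mul, h2]
    rw [← sub_self t] at h1
    have h3 := HasDerivAt.comp_sub_const t t h1
    rwa [h2] at h3
  have h4 := eq_exp_mul_of_hasDerivAt h t
  simpa [hq, hφ.zero, hφ.modelDeriv_zero] using h4

theorem hamiltonian_flow (hs : IsScalingSymmetry Ω H φ Λ) (hφ : IsGlobalFlow D φ) (t : ℝ) (m : M) :
    H (φ t m) = Real.exp (Λ * t) * H m := by
  have h : ∀ t, HasDerivAt (fun t => H (φ t m)) (Λ * H (φ t m)) t := by
    intro t
    have h1 := hs.hamiltonian (φ t m)
    rw [← sub_self t] at h1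
    have h3 := HasDerivAt.comp_sub_const t t h1
    have h2 : (fun t => H (φ t m)) = fun r => H (φ (r - t) (φ t m)) := by
      funext r
      rw [← hφ.add, sub_add_cancel]
    rwa [h2]
  have h4 := eq_exp_mul_of_hasDerivAt h t
  rwa [hφ.zero] at h4

theorem modelDeriv_flow (hs : IsScalingSymmetry Ω H φ Λ) (hφ : IsGlobalFlow D φ)
    (hH : MDifferentiable 𝓘(ℝ, E) 𝓘(ℝ, ℝ) H) (t : ℝ) (m : M) (u : E) :
    modelDeriv E ℝ H (φ t m) (modelDeriv E E (φ t) m u) =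
      Real.exp (Λ * t) * modelDeriv E ℝ H m u := by
  rw [← modelDeriv_comp _ _ _ (hH _) (hφ.mdifferentiableAt_apply t m)]
  have h1 : (fun m => H (φ t m)) = Real.exp (Λ * t) • H :=
    funext fun m => hs.hamiltonian_flow hφ t m
  have h2 : modelDeriv E ℝ (Real.exp (Λ * t) • H) m = Real.exp (Λ * t) • modelDeriv E ℝ H m :=
    const_smul_mfderiv (hH m) _
  rw [h1, h2]
  rfl

theorem modelDeriv_generator (hs : IsScalingSymmetry Ω H φ Λ) (hφ : IsGlobalFlow D φ)
    (hH : MDifferentiable 𝓘(ℝ, E) 𝓘(ℝ, ℝ) H) (m : M) :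
    modelDeriv E ℝ H m (D m) = Λ * H m := by
  have h1 := (hφ.hasVelocityAt 0 m).map (hH (φ 0 m))
  have h2 := h1.unique (hasVelocityAt_iff_hasDerivAt.2 (hs.hamiltonian m))
  rwa [hφ.zero] at h2

/-- Paired with `dφ_t v`, the left side gives `-e^t dH(v)` and the right side `-e^{(1-Λ)t} e^{Λt}
dH(v)`. Every vector is of the form `dφ_t v`, so non-degeneracy concludes. -/
theorem hamiltonianField_flow [FiniteDimensional ℝ E] (hs : IsScalingSymmetry Ω H φ Λ)
    (hφ : IsGlobalFlow D φ) (hH : MDifferentiable 𝓘(ℝ, E) 𝓘(ℝ, ℝ) H) (t : ℝ) (m : M) :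
    modelDeriv E E (φ t) m (Ω.hamiltonian H m) =
      Real.exp ((1 - Λ) * t) • Ω.hamiltonian H (φ t m) := by
  rw [← sub_eq_zero]
  refine Ω.eq_zero_of_pairing (φ t m) _ fun w => ?_
  obtain ⟨v, rfl⟩ := hφ.exists_modelDeriv_eq t m w
  rw [map_sub, LinearMap.sub_apply, hs.pairing_flow hφ, map_smul, LinearMap.smul_apply,
    Ω.pairing_hamiltonian, Ω.pairing_hamiltonian, hs.modelDeriv_flow hφ hH, smul_eq_mul, mul_neg,
    mul_neg, ← mul_assoc, ← Real.exp_add]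
  ring_nf

end IsScalingSymmetry

end Scaling

/-! ### The kernel of the quotient map -/

section Quotient

variable {E : Type*} [NormedAddCommGroup E] [NormedSpace ℝ E]
  {M : Type*} [TopologicalSpace M] [ChartedSpace E M]
  {E' : Type*} [NormedAddCommGroup E'] [NormedSpace ℝ E']
  {C : Type*} [TopologicalSpace C] [ChartedSpace E' C]
  {D : M → E} {φ : ℝ → M → M} {π : M → C}

/-- At a zero of `D` the constant curve is an integral curve, so by uniqueness `φ_1` fixes the
point, against freeness. -/
theorem IsGlobalFlow.generator_ne_zero [CompleteSpace E] [IsManifold 𝓘(ℝ, E) ∞ M] [T2Space M]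
    (hφ : IsGlobalFlow D φ)
    (hD : ContMDiff 𝓘(ℝ, E) 𝓘(ℝ, E).tangent ∞ (fun m => tangentMk E m (D m)))
    (hfree : IsFreeProper φ) (m : M) : D m ≠ 0 := by
  intro h0
  have h1 : IsMIntegralCurve (I := 𝓘(ℝ, E)) (fun _ : ℝ => m) D := by
    intro t
    have := hasVelocityAt_const (E := E) m t
    rw [← h0] at this
    exact this
  have : IsManifold 𝓘(ℝ, E) 1 M := IsManifold.of_le (n := ∞) (by simp)
  have h2 := isMIntegralCurve_Ioo_eq_of_contMDiff_boundaryless (t₀ := 0) (I := 𝓘(ℝ, E)) (v := D)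
    (hD.of_le (by simp)) (hφ.integralCurve m) h1 (hφ.zero m)
  exact one_ne_zero (hfree.free 1 m (congrFun h2 1))

theorem IsGlobalFlow.injective_orbit (hφ : IsGlobalFlow D φ) (hfree : IsFreeProper φ) {s t : ℝ}
    {m : M} (h : φ s m = φ t m) : s = t := by
  have h1 : φ (-t + s) m = m := by rw [hφ.add, h, hφ.neg_apply]
  have := hfree.free _ _ h1
  linarith

namespace IsQuotientByFlow

theorem map_flow (hπ : IsQuotientByFlow E E' φ π) (t : ℝ) (m : M) : π (φ t m) = π m :=
  ((hπ.fibre m _).2 ⟨t, rfl⟩).symm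

theorem contMDiff [IsManifold 𝓘(ℝ, E) ∞ M] [IsManifold 𝓘(ℝ, E') ∞ C]
    (hπ : IsQuotientByFlow E E' φ π) : ContMDiff 𝓘(ℝ, E) 𝓘(ℝ, E') ∞ π :=
  hπ.submersion.contMDiff

variable [IsManifold 𝓘(ℝ, E) ∞ M] [IsManifold 𝓘(ℝ, E') ∞ C]

theorem mdifferentiableAt (hπ : IsQuotientByFlow E E' φ π) (m : M) :
    MDifferentiableAt 𝓘(ℝ, E) 𝓘(ℝ, E') π m :=
  hπ.contMDiff.mdifferentiable (by simp) m

theorem modelDeriv_flow (hπ : IsQuotientByFlow E E' φ π) (hφ : IsGlobalFlow D φ) (t : ℝ) (m : M)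
    (u : E) : modelDeriv E E' π (φ t m) (modelDeriv E E (φ t) m u) = modelDeriv E E' π m u := by
  rw [← modelDeriv_comp _ _ _ (hπ.mdifferentiableAt _) (hφ.mdifferentiableAt_apply t m)]
  have h1 : (fun m => π (φ t m)) = π := funext fun m => hπ.map_flow t m
  rw [h1]

theorem modelDeriv_generator (hπ : IsQuotientByFlow E E' φ π) (hφ : IsGlobalFlow D φ) (m : M) :
    modelDeriv E E' π m (D m) = 0 := by
  have h1 := (hφ.hasVelocityAt 0 m).map (hπ.mdifferentiableAt (φ 0 m))
  have h2 : (fun s => π (φ s m)) = fun _ => π m := funext fun s => hπ.map_flow s m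
  rw [h2] at h1
  have h3 := h1.unique (hasVelocityAt_const _ _)
  rwa [hφ.zero] at h3

/-- The derivative of a local section is a right inverse. -/
theorem modelDeriv_surjective (hπ : IsQuotientByFlow E E' φ π) (m : M) :
    Function.Surjective (modelDeriv E E' π m) := by
  obtain ⟨U, σ, hU, hm, hσ, hσm, hπσ⟩ := hπ.submersion.exists_localSection m
  intro w
  have h1 : (fun c => π (σ c)) =ᶠ[𝓝 (π m)] fun c => c :=
    Filter.eventually_of_mem (hU.mem_nhds hm) hπσ
  have h2 : MDifferentiableAt 𝓘(ℝ, E') 𝓘(ℝ, E) σ (π m) :=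
    (hσ.contMDiffAt (hU.mem_nhds hm)).mdifferentiableAt (by simp)
  have h3 := modelDeriv_comp π σ (π m) (hπ.mdifferentiableAt _) h2 w
  rw [modelDeriv_congr h1, modelDeriv_id, hσm] at h3
  exact ⟨_, h3.symm⟩

/-- The kernel of `dπ` has dimension one by rank-nullity, and it contains the non-zero vector `D m`.
-/
theorem exists_eq_smul [FiniteDimensional ℝ E] [FiniteDimensional ℝ E']
    (hdim : Module.finrank ℝ E = Module.finrank ℝ E' + 1)
    (hπ : IsQuotientByFlow E E' φ π) (hφ : IsGlobalFlow D φ) (m : M) (hDm : D m ≠ 0)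
    {u : E} (hu : modelDeriv E E' π m u = 0) : ∃ a : ℝ, u = a • D m := by
  set L : E →ₗ[ℝ] E' := (modelDeriv E E' π m : E →ₗ[ℝ] E')
  have h1 := L.finrank_range_add_finrank_ker
  have h2 : LinearMap.range L = ⊤ := LinearMap.range_eq_top.2 (hπ.modelDeriv_surjective m)
  rw [h2, finrank_top, hdim] at h1
  have h3 : Module.finrank ℝ (LinearMap.ker L) = 1 := by omega
  obtain ⟨a, ha⟩ := (finrank_eq_one_iff_of_nonzero' (⟨D m, hπ.modelDeriv_generator hφ m⟩ :
    LinearMap.ker L) (fun h => hDm (congrArg Subtype.val h))).1 h3 ⟨u, hu⟩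
  exact ⟨a, (congrArg Subtype.val ha).symm⟩

end IsQuotientByFlow

end Quotient

/-! ### Smoothness of the Hamiltonian vector field -/

section HamiltonianSmooth

variable {E : Type*} [NormedAddCommGroup E] [NormedSpace ℝ E]
  {M : Type*} [TopologicalSpace M] [ChartedSpace E M]

theorem contMDiffAt_extChartAt_symm [IsManifold 𝓘(ℝ, E) ∞ M] {x : M} {y : E}
    (hy : y ∈ (extChartAt 𝓘(ℝ, E) x).target) :
    ContMDiffAt 𝓘(ℝ, E) 𝓘(ℝ, E) ∞ (extChartAt 𝓘(ℝ, E) x).symm y := by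
  have := contMDiffWithinAt_extChartAt_symm_range (I := 𝓘(ℝ, E)) (n := ∞) x hy
  rwa [ModelWithCorners.range_eq_univ, contMDiffWithinAt_univ] at this

theorem trivializationAt_tangentMk [IsManifold 𝓘(ℝ, E) 1 M] {x m : M}
    (hm : m ∈ (chartAt E x).source) (u : E) :
    (trivializationAt E (TangentSpace 𝓘(ℝ, E)) x (tangentMk E m u)).2 =
      modelDeriv E E (extChartAt 𝓘(ℝ, E) x) m u := by
  have h1 := TangentBundle.continuousLinearMapAt_trivializationAt (I := 𝓘(ℝ, E)) hm
  have hmem : m ∈ (trivializationAt E (TangentSpace 𝓘(ℝ, E)) x).baseSet := by simpa using hm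
  have h2 : (trivializationAt E (TangentSpace 𝓘(ℝ, E)) x).continuousLinearMapAt ℝ m u =
      (trivializationAt E (TangentSpace 𝓘(ℝ, E)) x ⟨m, u⟩).2 :=
    congrFun (Bundle.Trivialization.coe_linearMapAt_of_mem
      (trivializationAt E (TangentSpace 𝓘(ℝ, E)) x) hmem) u
  exact h2.symm.trans (congrArg (fun L : E →L[ℝ] E => L u) h1)

/-- A vector field is smooth at `x` iff its coordinates in the chart at `x` are. -/
theorem contMDiffAt_tangentMk_iff [IsManifold 𝓘(ℝ, E) ∞ M] {X : M → E} {x : M} :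
    ContMDiffAt 𝓘(ℝ, E) 𝓘(ℝ, E).tangent ∞ (fun m => tangentMk E m (X m)) x ↔
      ContMDiffAt 𝓘(ℝ, E) 𝓘(ℝ, E) ∞
        (fun m => modelDeriv E E (extChartAt 𝓘(ℝ, E) x) m (X m)) x := by
  have : IsManifold 𝓘(ℝ, E) 1 M := IsManifold.of_le (n := ∞) (by simp)
  have h := Bundle.contMDiffAt_section (IB := 𝓘(ℝ, E)) (F := E) (E := TangentSpace 𝓘(ℝ, E) (M := M))
    (n := ∞) (s := X) x
  refine h.trans (Filter.EventuallyEq.contMDiffAt_iff ?_)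
  filter_upwards [chart_source_mem_nhds E x] with m hm
  exact trivializationAt_tangentMk hm (X m)

theorem modelDeriv_extChartAt_symm_modelDeriv [IsManifold 𝓘(ℝ, E) ∞ M] {x m : M}
    (hm : m ∈ (extChartAt 𝓘(ℝ, E) x).source) (u : E) :
    modelDeriv E E (extChartAt 𝓘(ℝ, E) x).symm (extChartAt 𝓘(ℝ, E) x m)
      (modelDeriv E E (extChartAt 𝓘(ℝ, E) x) m u) = u := by
  have : IsManifold 𝓘(ℝ, E) 1 M := IsManifold.of_le (n := ∞) (by simp)
  rw [← modelDeriv_comp _ _ _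
    ((contMDiffAt_extChartAt_symm ((extChartAt 𝓘(ℝ, E) x).map_source hm)).mdifferentiableAt
      (by simp)) (mdifferentiableAt_extChartAt (by simpa using hm))]
  have h : (fun y => (extChartAt 𝓘(ℝ, E) x).symm (extChartAt 𝓘(ℝ, E) x y)) =ᶠ[𝓝 m] fun y => y :=
    Filter.eventually_of_mem (extChartAt_source_mem_nhds' (I := 𝓘(ℝ, E)) hm)
      fun y hy => (extChartAt 𝓘(ℝ, E) x).left_inv hy
  rw [modelDeriv_congr h, modelDeriv_id]

/-- In a chart, the defining equation reads `B(y) X = K(y)`, where `B` is the curried form and `K`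
is minus the differential of `H`. Both are smooth in `y`, each `B(y)` is invertible, and inversion
of operators is smooth. -/
theorem SymplecticForm.contMDiff_hamiltonian [FiniteDimensional ℝ E] [IsManifold 𝓘(ℝ, E) ∞ M]
    (Ω : SymplecticForm E M) {H : M → ℝ} (hH : ContMDiff 𝓘(ℝ, E) 𝓘(ℝ, ℝ) ∞ H) :
    ContMDiff 𝓘(ℝ, E) 𝓘(ℝ, E).tangent ∞ (fun m => tangentMk E m (Ω.hamiltonian H m)) := by
  intro x
  rw [contMDiffAt_tangentMk_iff]
  set e := extChartAt 𝓘(ℝ, E) x with he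
  let J : E [⋀^Fin 2]→L[ℝ] ℝ →L[ℝ] E →L[ℝ] E [⋀^Fin 1]→L[ℝ] ℝ :=
    (ContinuousAlternatingMap.curryLeftLI (𝕜 := ℝ) (E := E) (F := ℝ)
      (n := 1)).toContinuousLinearMap
  have hJ : ContDiff ℝ ∞ J := ContinuousLinearMap.contDiff _
  let B : E → E →L[ℝ] E [⋀^Fin 1]→L[ℝ] ℝ := fun y =>
    J (formInChart Ω.form x y)
  have hBapp : ∀ y u v, B y u ![v] =
      Ω.pairing (e.symm y) (modelDeriv E E e.symm y u) (modelDeriv E E e.symm y v) := by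
    intro y u v
    have h1 : B y u ![v] = formInChart Ω.form x y ![u, v] := rfl
    rw [h1]
    let η : E [⋀^Fin 2]→L[ℝ] ℝ := Ω.form (e.symm y)
    have h2 : formInChart Ω.form x y ![u, v] = η (modelDeriv E E e.symm y ∘ ![u, v]) := rfl
    rw [h2]
    have h3 : modelDeriv E E e.symm y ∘ ![u, v] =
      ![modelDeriv E E e.symm y u, modelDeriv E E e.symm y v] := by
        funext i; fin_cases i <;> rfl
    rw [h3]
    rfl
  have hB : ContDiffOn ℝ ∞ B e.target :=
    hJ.comp_contDiffOn (Ω.smooth x)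
  have hsymm : ∀ y ∈ e.target, MDifferentiableAt 𝓘(ℝ, E) 𝓘(ℝ, E) e.symm y := fun y hy =>
    (contMDiffAt_extChartAt_symm hy).mdifferentiableAt (by simp)
  have hed : ∀ m ∈ e.source, MDifferentiableAt 𝓘(ℝ, E) 𝓘(ℝ, E) e m := fun m hm =>
    mdifferentiableAt_extChartAt (by simpa [he] using hm)
  have hle : ∀ m ∈ e.source, ∀ u,
      modelDeriv E E e.symm (e m) (modelDeriv E E e m u) = u := fun m hm =>
    modelDeriv_extChartAt_symm_modelDeriv hm
  have hre : ∀ m ∈ e.source, ∀ u,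
      modelDeriv E E e m (modelDeriv E E e.symm (e m) u) = u := by
    intro m hm u
    have h0 := modelDeriv_comp e e.symm (e m) (by rw [e.left_inv hm]; exact hed m hm)
      (hsymm _ (e.map_source hm)) u
    rw [e.left_inv hm] at h0
    have : (fun x => e (e.symm x)) =ᶠ[𝓝 (e m)] fun x => x :=
      Filter.eventually_of_mem ((isOpen_extChartAt_target (I := 𝓘(ℝ, E)) x).mem_nhds
        (e.map_source hm)) fun x hx => e.right_inv hx
    rw [modelDeriv_congr this, modelDeriv_id] at h0
    exact h0.symm
  -- Currying a 2-form produces alternating maps of degree one; `ι` identifies these with linear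
  -- functionals.
  let ι : (E →L[ℝ] ℝ) ≃ₗᵢ[ℝ] E [⋀^Fin 1]→L[ℝ] ℝ :=
    ContinuousAlternatingMap.ofSubsingletonLIE (ι := Fin 1) (0 : Fin 1)
  have hinv : ∀ m ∈ e.source, ∃ L : E ≃L[ℝ] E [⋀^Fin 1]→L[ℝ] ℝ, (L : E →L[ℝ] _) = B (e m) := by
    intro m hm
    have hinj : Function.Injective (B (e m)) := by
      rw [injective_iff_map_eq_zero]
      intro u hu
      have h1 : modelDeriv E E e.symm (e m) u = 0 := by
        refine Ω.eq_zero_of_pairing (e.symm (e m)) _ fun v => ?_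
        have h2 := hBapp (e m) u (modelDeriv E E e m v)
        rw [hle m hm, hu] at h2
        exact h2.symm
      rw [← hre m hm u, h1, map_zero]
    have hfin : FiniteDimensional ℝ (E [⋀^Fin 1]→L[ℝ] ℝ) :=
      LinearEquiv.finiteDimensional ι.toLinearEquiv
    have hdim : Module.finrank ℝ E = Module.finrank ℝ (E [⋀^Fin 1]→L[ℝ] ℝ) := by
      rw [← ι.toLinearEquiv.finrank_eq, ← (LinearMap.toContinuousLinearMap (𝕜 := ℝ) (E := E)
        (F' := ℝ)).finrank_eq]
      exact (Subspace.dual_finrank_eq (K := ℝ) (V := E)).symm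
    refine ⟨(LinearEquiv.ofInjectiveOfFinrankEq (B (e m) : E →ₗ[ℝ] _) hinj hdim).toContinuousLinearEquiv, ?_⟩
    ext u
    rfl
  let K : E → E →L[ℝ] ℝ := fun y => -fderiv ℝ (fun y => H (e.symm y)) y
  have hHe : ContDiffOn ℝ ∞ (fun y => H (e.symm y)) e.target := by
    intro y hy
    exact ((hH _).comp y (contMDiffAt_extChartAt_symm hy)).contDiffAt.contDiffWithinAt
  have hxt : e x ∈ e.target := mem_extChartAt_target x
  have hto : e.target ∈ 𝓝 (e x) := (isOpen_extChartAt_target (I := 𝓘(ℝ, E)) x).mem_nhds hxt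
  have hK : ContDiffAt ℝ ∞ K (e x) :=
    ((hHe.contDiffAt hto).fderiv_right (m := ∞) (by simp)).neg
  have hXeq : ∀ m ∈ e.source, modelDeriv E E e m (Ω.hamiltonian H m) =
      (B (e m)).inverse (ι (K (e m))) := by
    intro m hm
    obtain ⟨L, hL⟩ := hinv m hm
    rw [← hL, ContinuousLinearMap.inverse_equiv]
    refine (L.eq_symm_apply).2 ?_
    have h1 : L (modelDeriv E E e m (Ω.hamiltonian H m)) =
      B (e m) (modelDeriv E E e m (Ω.hamiltonian H m)) := congrArg (fun A : E →L[ℝ] _ => A _) hL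
    rw [h1]
    ext w
    have hw : w = ![w 0] := by funext i; fin_cases i; rfl
    rw [hw, hBapp, hle m hm, e.left_inv hm, Ω.pairing_hamiltonian]
    have h2 := modelDeriv_comp H e.symm (e m) ((hH _).mdifferentiableAt (by simp))
      (hsymm _ (e.map_source hm)) (w 0)
    have h3 : modelDeriv E ℝ (fun y => H (e.symm y)) (e m) =
      fderiv ℝ (fun y => H (e.symm y)) (e m) := mfderiv_eq_fderiv
    rw [h3, e.left_inv hm] at h2
    rw [← h2]
    rfl
  have hmain : ContDiffAt ℝ ∞ (fun y => (B y).inverse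
      (ι (K y))) (e x) := by
    obtain ⟨L, hL⟩ := hinv x (mem_extChartAt_source x)
    have h1 : ContDiffAt ℝ ∞ (fun y => (B y).inverse) (e x) := by
      have h2 := contDiffAt_map_inverse (n := ∞) L
      rw [hL] at h2
      exact h2.comp (e x) (hB.contDiffAt hto)
    exact h1.clm_apply ((LinearIsometryEquiv.contDiff _).contDiffAt.comp (e x) hK)
  have h5 : ContMDiffAt 𝓘(ℝ, E) 𝓘(ℝ, E) ∞ e x := contMDiffAt_extChartAt
  refine (hmain.contMDiffAt.comp x h5).congr_of_eventuallyEq ?_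
  filter_upwards [extChartAt_source_mem_nhds (I := 𝓘(ℝ, E)) x] with m hm
  exact hXeq m hm

end HamiltonianSmooth

/-! ### A global section, by averaging local time functions -/

section GlobalSection

variable {E : Type*} [NormedAddCommGroup E] [NormedSpace ℝ E] [FiniteDimensional ℝ E]
  {M : Type*} [TopologicalSpace M] [ChartedSpace E M] [IsManifold 𝓘(ℝ, E) ∞ M]
  {E' : Type*} [NormedAddCommGroup E'] [NormedSpace ℝ E'] [FiniteDimensional ℝ E']
  {C : Type*} [TopologicalSpace C] [ChartedSpace E' C] [IsManifold 𝓘(ℝ, E') ∞ C]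
  {D : M → E} {φ : ℝ → M → M} {π : M → C}

namespace IsQuotientByFlow

/-- The flow, parametrized by a local section, is locally invertible. -/
theorem bijective_mfderiv_flow_section
    (hdim : Module.finrank ℝ E = Module.finrank ℝ E' + 1)
    (hπ : IsQuotientByFlow E E' φ π) (hφ : IsGlobalFlow D φ) (hD0 : ∀ m, D m ≠ 0)
    {U : Set C} (hU : IsOpen U) {σ : C → M} (hσ : ContMDiffOn 𝓘(ℝ, E') 𝓘(ℝ, E) ∞ σ U)
    (hπσ : ∀ c ∈ U, π (σ c) = c) {c : C} (hc : c ∈ U) :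
    Function.Bijective (mfderiv (𝓘(ℝ, ℝ).prod 𝓘(ℝ, E')) 𝓘(ℝ, E)
      (fun p : ℝ × C => φ p.1 (σ p.2)) ((0 : ℝ), c)) := by
  have hσd : MDifferentiableAt 𝓘(ℝ, E') 𝓘(ℝ, E) σ c :=
    (hσ.contMDiffAt (hU.mem_nhds hc)).mdifferentiableAt (by simp)
  have hG : MDifferentiableAt (𝓘(ℝ, ℝ).prod 𝓘(ℝ, E')) 𝓘(ℝ, E)
      (fun p : ℝ × C => φ p.1 (σ p.2)) ((0 : ℝ), c) := by
    have h1 : MDifferentiableAt (𝓘(ℝ, ℝ).prod 𝓘(ℝ, E)) 𝓘(ℝ, E) (fun p : ℝ × M => φ p.1 p.2)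
      ((0 : ℝ), σ c) := hφ.smooth.mdifferentiable (by simp) _
    have h2 : MDifferentiableAt (𝓘(ℝ, ℝ).prod 𝓘(ℝ, E')) 𝓘(ℝ, E)
      (fun p : ℝ × C => σ p.2) ((0 : ℝ), c) :=
      MDifferentiableAt.comp (I' := 𝓘(ℝ, E')) ((0 : ℝ), c) hσd mdifferentiableAt_snd
    exact MDifferentiableAt.comp (I' := 𝓘(ℝ, ℝ).prod 𝓘(ℝ, E)) ((0 : ℝ), c) h1
      (mdifferentiableAt_fst.prodMk h2)
  let L : ℝ × E' →L[ℝ] E := mfderiv (𝓘(ℝ, ℝ).prod 𝓘(ℝ, E')) 𝓘(ℝ, E)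
      (fun p : ℝ × C => φ p.1 (σ p.2)) ((0 : ℝ), c)
  -- Applying `dπ` to this formula kills the `D` term and returns `w`. This gives injectivity, and
  -- equality of dimensions gives the rest.
  have hL : ∀ b w, L (b, w) = b • D (σ c) + modelDeriv E' E σ c w := by
    intro b w
    have h1 : L (b, w) = modelDeriv ℝ E (fun s => φ s (σ c)) 0 b +
      modelDeriv E' E (fun c => φ 0 (σ c)) c w := mfderiv_prod_eq_add_apply hG (v := (b, w))
    have h2 : (fun c => φ 0 (σ c)) = σ := funext fun c => hφ.zero _
    have h3 := (hφ.hasVelocityAt 0 (σ c)).mfderiv_one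
    have h4 : modelDeriv ℝ E (fun s => φ s (σ c)) 0 b = b • D (σ c) := by
      rw [hφ.zero] at h3
      rw [← h3, ← map_smul]
      simp
    rw [h1, h2, h4]
  have hπσ' : ∀ w, modelDeriv E E' π (σ c) (modelDeriv E' E σ c w) = w := by
    intro w
    rw [← modelDeriv_comp _ _ _ (hπ.mdifferentiableAt _) hσd]
    have : (fun c => π (σ c)) =ᶠ[𝓝 c] fun c => c :=
      Filter.eventually_of_mem (hU.mem_nhds hc) hπσ
    rw [modelDeriv_congr this, modelDeriv_id]
  have hinj : Function.Injective L := by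
    rw [injective_iff_map_eq_zero]
    rintro ⟨b, w⟩ h
    rw [hL] at h
    have hw : w = 0 := by
      have := congrArg (modelDeriv E E' π (σ c)) h
      simpa [hπ.modelDeriv_generator hφ, hπσ'] using this
    subst hw
    have hb : b = 0 := by
      simpa [hD0] using h
    rw [hb]; rfl
  have hfin : Module.finrank ℝ (ℝ × E') = Module.finrank ℝ E := by
    rw [Module.finrank_prod, Module.finrank_self, hdim, add_comm]
  have hsurj : Function.Surjective L :=
    (LinearMap.injective_iff_surjective_of_finrank_eq_finrank (f := (L : ℝ × E' →ₗ[ℝ] E)) hfin).1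
      hinj
  exact ⟨hinj, hsurj⟩

/-- The function `h` is the time needed to flow from a local section to the given point, unique by
freeness. It is smooth near the section by the inverse function theorem, and equivariance carries
this along the orbits. -/
theorem exists_local_slice (hdim : Module.finrank ℝ E = Module.finrank ℝ E' + 1)
    (hπ : IsQuotientByFlow E E' φ π) (hφ : IsGlobalFlow D φ) (hfree : IsFreeProper φ)
    (hD0 : ∀ m, D m ≠ 0) (c : C) :
    ∃ (U : Set C) (h : M → ℝ), IsOpen U ∧ c ∈ U ∧
      (∀ m, π m ∈ U → ContMDiffAt 𝓘(ℝ, E) 𝓘(ℝ, ℝ) ∞ h m) ∧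
      ∀ m t, π m ∈ U → h (φ t m) = h m + t := by
  obtain ⟨m0, rfl⟩ := hπ.surjective c
  obtain ⟨U, σ, hU, hm0, hσ, -, hπσ⟩ := hπ.submersion.exists_localSection m0
  have hex : ∀ m, ∃ t, π m ∈ U → φ t (σ (π m)) = m := by
    intro m
    by_cases hm : π m ∈ U
    · obtain ⟨t, ht⟩ := (hπ.fibre (σ (π m)) m).1 (hπσ _ hm)
      exact ⟨t, fun _ => ht⟩
    · exact ⟨0, fun h => absurd h hm⟩
  choose h hh using hex
  have huniq : ∀ m t, π m ∈ U → φ t (σ (π m)) = m → h m = t := fun m t hm ht =>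
    hφ.injective_orbit hfree ((hh m hm).trans ht.symm)
  have hequi : ∀ m t, π m ∈ U → h (φ t m) = h m + t := by
    intro m t hm
    refine huniq _ _ (by rwa [hπ.map_flow]) ?_
    rw [hπ.map_flow, add_comm, hφ.add, hh m hm]
  have hπc : Continuous π := hπ.contMDiff.continuous
  have hslice : ∀ c ∈ U, ContMDiffAt 𝓘(ℝ, E) 𝓘(ℝ, ℝ) ∞ h (σ c) := by
    intro c hc
    have hG : ContMDiffAt (𝓘(ℝ, ℝ).prod 𝓘(ℝ, E')) 𝓘(ℝ, E) ∞
        (fun p : ℝ × C => φ p.1 (σ p.2)) ((0 : ℝ), c) := by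
      have h2 : ContMDiffAt (𝓘(ℝ, ℝ).prod 𝓘(ℝ, E')) 𝓘(ℝ, E) ∞
        (fun p : ℝ × C => σ p.2) ((0 : ℝ), c) :=
        ContMDiffAt.comp (I' := 𝓘(ℝ, E')) ((0 : ℝ), c) (hσ.contMDiffAt (hU.mem_nhds hc))
          contMDiffAt_snd
      exact ContMDiffAt.comp (I' := 𝓘(ℝ, ℝ).prod 𝓘(ℝ, E)) ((0 : ℝ), c) hφ.smooth.contMDiffAt
        (contMDiffAt_fst.prodMk h2)
    obtain ⟨θ, hθ, hθ0, hGθ⟩ := hG.exists_rightInverse (by simp)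
      (hπ.bijective_mfderiv_flow_section hdim hφ hD0 hU hσ hπσ hc)
    simp only [hφ.zero] at hθ hθ0 hGθ
    have hfst : ContMDiffAt 𝓘(ℝ, E) 𝓘(ℝ, ℝ) ∞ (fun m => (θ m).1) (σ c) :=
      ContMDiffAt.comp (I' := 𝓘(ℝ, ℝ).prod 𝓘(ℝ, E')) (σ c) contMDiffAt_fst hθ
    refine hfst.congr_of_eventuallyEq ?_
    have hmem : ∀ᶠ m in 𝓝 (σ c), (θ m).2 ∈ U := by
      refine (continuous_snd.continuousAt.comp hθ.continuousAt).eventually_mem ?_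
      simpa [hθ0] using hU.mem_nhds hc
    filter_upwards [hGθ, hmem] with m h1 h2
    have h3 : π m = (θ m).2 := by rw [← h1, hπ.map_flow, hπσ _ h2, h1]
    exact huniq m _ (h3 ▸ h2) (by rw [h3]; exact h1)
  refine ⟨U, h, hU, hm0, fun m hm => ?_, hequi⟩
  -- The fixed-time map `φ (-h m)` sends `m` onto the section, where smoothness is known. By
  -- equivariance the function written here agrees with `h` near `m`.
  have h1 : ContMDiffAt 𝓘(ℝ, E) 𝓘(ℝ, ℝ) ∞ (fun m' => h (φ (-h m) m') + h m) m := by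
    have h2 : φ (-h m) m = σ (π m) := by
      have h3 := hφ.neg_apply (h m) (σ (π m))
      rwa [hh m hm] at h3
    have h3 : ContMDiffAt 𝓘(ℝ, E) 𝓘(ℝ, ℝ) ∞ (fun m' => h (φ (-h m) m')) m :=
      ContMDiffAt.comp m (by rw [h2]; exact hslice _ hm) (hφ.contMDiff_apply _).contMDiffAt
    exact h3.add contMDiffAt_const
  refine h1.congr_of_eventuallyEq ?_
  filter_upwards [(hU.preimage hπc).mem_nhds hm] with m' hm'
  rw [hequi m' _ hm']
  ring

/-- The condition `h ∘ φ_t = h + t` survives convex combinations whose weights are constant on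
orbits, such as a partition of unity pulled back from `C`. -/
theorem exists_slice [T2Space C] [SigmaCompactSpace C]
    (hdim : Module.finrank ℝ E = Module.finrank ℝ E' + 1)
    (hπ : IsQuotientByFlow E E' φ π) (hφ : IsGlobalFlow D φ) (hfree : IsFreeProper φ)
    (hD0 : ∀ m, D m ≠ 0) :
    ∃ h : M → ℝ, ContMDiff 𝓘(ℝ, E) 𝓘(ℝ, ℝ) ∞ h ∧ ∀ m t, h (φ t m) = h m + t := by
  choose U k hU hcU hk hequi using hπ.exists_local_slice hdim hφ hfree hD0
  obtain ⟨ρ, hρ⟩ := SmoothPartitionOfUnity.exists_isSubordinate 𝓘(ℝ, E') (s := Set.univ)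
    isClosed_univ U hU (fun c _ => Set.mem_iUnion.2 ⟨c, hcU c⟩)
  have hπc : Continuous π := hπ.contMDiff.continuous
  refine ⟨fun m => ∑ᶠ i, ρ i (π m) * k i m, contMDiff_finsum (fun i m => ?_) ?_, fun m t => ?_⟩
  · by_cases hm : π m ∈ U i
    · exact ((ρ i).contMDiff.comp hπ.contMDiff).contMDiffAt.mul (hk i m hm)
    -- Nothing is known about `k i` away from the preimage of `U i`, but there the weight vanishes
    -- on a whole neighbourhood.
    · have h1 : π m ∉ tsupport (ρ i) := fun h => hm (hρ i h)
      have h2 : (fun m => ρ i (π m) * k i m) =ᶠ[𝓝 m] fun _ => 0 := by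
        filter_upwards [((isClosed_tsupport (ρ i)).isOpen_compl.preimage hπc).mem_nhds h1]
          with m' hm'
        rw [image_eq_zero_of_notMem_tsupport hm', zero_mul]
      exact contMDiffAt_const.congr_of_eventuallyEq h2
  · refine (ρ.locallyFinite.preimage_continuous hπc).subset fun i m hm => ?_
    exact left_ne_zero_of_mul hm
  · have hfin : (Function.support fun i => ρ i (π m)).Finite :=
      ρ.locallyFinite.point_finite (π m)
    have h1 : ∀ i, ρ i (π (φ t m)) * k i (φ t m) = ρ i (π m) * k i m + ρ i (π m) * t := by
      intro i
      rw [hπ.map_flow]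
      by_cases hm : π m ∈ U i
      · rw [hequi i m t hm, mul_add]
      · have h1 : π m ∉ tsupport (ρ i) := fun h => hm (hρ i h)
        simp [image_eq_zero_of_notMem_tsupport h1]
    simp_rw [h1]
    rw [finsum_add_distrib (hfin.subset fun i hi => left_ne_zero_of_mul hi)
      (hfin.subset fun i hi => left_ne_zero_of_mul hi), ← finsum_mul' _ _ hfin,
      ρ.sum_eq_one (Set.mem_univ _), one_mul]

/-- A global smooth section of the quotient map, and the time function measuring the distance to
it along the flow. -/
theorem exists_section [T2Space C] [SigmaCompactSpace C]
    (hdim : Module.finrank ℝ E = Module.finrank ℝ E' + 1)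
    (hπ : IsQuotientByFlow E E' φ π) (hφ : IsGlobalFlow D φ) (hfree : IsFreeProper φ)
    (hD0 : ∀ m, D m ≠ 0) :
    ∃ (σ : C → M) (h : M → ℝ), ContMDiff 𝓘(ℝ, E') 𝓘(ℝ, E) ∞ σ ∧ ContMDiff 𝓘(ℝ, E) 𝓘(ℝ, ℝ) ∞ h ∧
      (∀ c, π (σ c) = c) ∧ (∀ c, h (σ c) = 0) ∧ (∀ m t, h (φ t m) = h m + t) ∧
      ∀ m, φ (h m) (σ (π m)) = m := by
  obtain ⟨h, hh, hequi⟩ := hπ.exists_slice hdim hφ hfree hD0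
  -- This map slides each point along its orbit to the zero level of `h`. It is constant on orbits,
  -- so it descends to the section.
  let s : M → M := fun m => φ (-h m) m
  have hs : ContMDiff 𝓘(ℝ, E) 𝓘(ℝ, E) ∞ s := hφ.smooth.comp (hh.neg.prodMk contMDiff_id)
  have hs' : ∀ m m', π m = π m' → s m = s m' := by
    intro m m' hm
    obtain ⟨t, rfl⟩ := (hπ.fibre m m').1 hm
    simp only [s]
    rw [hequi, ← hφ.add]
    congr 1
    ring
  let σ : C → M := fun c => s (Function.surjInv hπ.surjective c)
  have hσs : ∀ m, σ (π m) = s m := fun m => hs' _ _ (Function.surjInv_eq hπ.surjective (π m))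
  have hπs : ∀ m, π (s m) = π m := fun m => hπ.map_flow _ _
  refine ⟨σ, h, fun c => ?_, hh, fun c => ?_, fun c => ?_, hequi, fun m => ?_⟩
  · obtain ⟨m, rfl⟩ := hπ.surjective c
    -- The chosen preimage need not vary continuously. Since `s` is constant on orbits, a smooth
    -- local section can replace it.
    obtain ⟨U, τ, hU, hm, hτ, -, hπτ⟩ := hπ.submersion.exists_localSection m
    have h1 : ContMDiffAt 𝓘(ℝ, E') 𝓘(ℝ, E) ∞ (fun c => s (τ c)) (π m) :=
      hs.contMDiffAt.comp (π m) (hτ.contMDiffAt (hU.mem_nhds hm))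
    refine h1.congr_of_eventuallyEq ?_
    filter_upwards [hU.mem_nhds hm] with c hc
    rw [← hσs, hπτ c hc]
  · exact (hπs _).trans (Function.surjInv_eq hπ.surjective c)
  · show h (φ _ _) = 0
    rw [hequi]
    ring
  · rw [hσs, hφ.apply_neg]

end IsQuotientByFlow

end GlobalSection

/-! ### Quadrature and change of time on an interval -/

section RealCurves

theorem ContinuousOn.exists_hasDerivAt {f : ℝ → ℝ} {s : Set ℝ} (hs : IsOpen s)
    (hs' : s.OrdConnected) (hf : ContinuousOn f s) : ∃ F : ℝ → ℝ, ∀ t ∈ s, HasDerivAt F (f t) t := by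
  rcases s.eq_empty_or_nonempty with rfl | ⟨t₀, ht₀⟩
  · exact ⟨fun _ => 0, fun t ht => ht.elim⟩
  · exact ⟨fun t => ∫ x in t₀..t, f x, fun t ht => intervalIntegral.integral_hasDerivAt_right
      (hf.mono (hs'.uIcc_subset ht₀ ht)).intervalIntegrable
      (hf.stronglyMeasurableAtFilter hs t ht) (hf.continuousAt (hs.mem_nhds ht))⟩

theorem contDiffOn_one_of_hasDerivAt {f f' : ℝ → ℝ} {s : Set ℝ} (hs : IsOpen s)
    (hf : ∀ t ∈ s, HasDerivAt f (f' t) t) (hf' : ContinuousOn f' s) : ContDiffOn ℝ 1 f s := by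
  rw [← zero_add (1 : WithTop ℕ∞), contDiffOn_succ_iff_deriv_of_isOpen hs]
  refine ⟨fun t ht => (hf t ht).differentiableAt.differentiableWithinAt, by simp, ?_⟩
  rw [contDiffOn_zero]
  exact hf'.congr fun t ht => (hf t ht).deriv

theorem isOpen_image_of_deriv_ne_zero {τ : ℝ → ℝ} {s : Set ℝ} (hs : IsOpen s)
    (hτ : ContDiffOn ℝ 1 τ s) (h0 : ∀ t ∈ s, deriv τ t ≠ 0) : IsOpen (τ '' s) := by
  rw [isOpen_iff_mem_nhds]
  rintro _ ⟨t, ht, rfl⟩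
  have hd : HasStrictDerivAt τ (deriv τ t) t :=
    (hτ.contDiffAt (hs.mem_nhds ht)).hasStrictDerivAt one_ne_zero
  rw [← hd.map_nhds_eq (h0 t ht)]
  exact Filter.image_mem_map (hs.mem_nhds ht)

/-- Injectivity is Rolle's theorem on the interval. Near `τ t`, the global inverse coincides with
the local one from the inverse function theorem, which supplies its derivative. -/
theorem exists_leftInverse_of_hasDerivAt {τ f : ℝ → ℝ} {s : Set ℝ} (hs : IsOpen s)
    (hs' : s.OrdConnected) (hτ : ∀ t ∈ s, HasDerivAt τ (f t) t) (hf : ContinuousOn f s)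
    (hf0 : ∀ t ∈ s, f t ≠ 0) :
    ∃ ρ : ℝ → ℝ, ∀ t ∈ s, ρ (τ t) = t ∧ HasDerivAt ρ (f t)⁻¹ (τ t) := by
  have key : ∀ a ∈ s, ∀ b ∈ s, a < b → τ a ≠ τ b := by
    intro a ha b hb hab heq
    have hsub := hs'.out ha hb
    obtain ⟨c, hc, hc0⟩ := exists_hasDerivAt_eq_zero hab
      (fun t ht => (hτ t (hsub ht)).continuousAt.continuousWithinAt) heq
      (fun t ht => hτ t (hsub (Set.Ioo_subset_Icc_self ht)))
    exact hf0 c (hsub (Set.Ioo_subset_Icc_self hc)) hc0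
  have hinj : Set.InjOn τ s := by
    intro a ha b hb hab
    by_contra hne
    rcases lt_or_gt_of_ne hne with h | h
    · exact key a ha b hb h hab
    · exact key b hb a ha h hab.symm
  refine ⟨Function.invFunOn τ s, fun t ht => ?_⟩
  have hinv : ∀ t ∈ s, Function.invFunOn τ s (τ t) = t := fun t ht =>
    hinj.leftInvOn_invFunOn ht
  refine ⟨hinv t ht, ?_⟩
  have hd : HasStrictDerivAt τ (f t) t :=
    (((contDiffOn_one_of_hasDerivAt hs hτ hf).contDiffAt (hs.mem_nhds ht)).hasStrictDerivAt'
      (hτ t ht) one_ne_zero)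
  have h1 := hd.to_localInverse (hf0 t ht)
  have h0 : hd.localInverse _ _ _ (hf0 t ht) (τ t) = t :=
    HasStrictFDerivAt.localInverse_apply_image _
  have h2 := hd.eventually_right_inverse (hf0 t ht)
  have h3 : ∀ᶠ y in 𝓝 (τ t), hd.localInverse _ _ _ (hf0 t ht) y ∈ s :=
    h1.hasDerivAt.continuousAt.eventually_mem (by rw [h0]; exact hs.mem_nhds ht)
  refine h1.hasDerivAt.congr_of_eventuallyEq ?_
  filter_upwards [h2, h3] with y hy hys
  conv_lhs => rw [← hy]
  exact hinv _ hys

end RealCurves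

/-! ### Continuity of velocities in charts -/

section ManifoldCurves

variable {E : Type*} [NormedAddCommGroup E] [NormedSpace ℝ E]
  {M : Type*} [TopologicalSpace M] [ChartedSpace E M] [IsManifold 𝓘(ℝ, E) 1 M]

theorem modelDeriv_extChartAt_injective {x m : M} (hm : m ∈ (extChartAt 𝓘(ℝ, E) x).source) :
    Function.Injective (modelDeriv E E (extChartAt 𝓘(ℝ, E) x) m) :=
  (isInvertible_mfderiv_extChartAt (I := 𝓘(ℝ, E)) hm).injective

theorem continuousOn_modelDeriv_extChartAt {X : Type*} [TopologicalSpace X] {s : Set X}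
    {y : X → M} {v : X → E} (hv : ContinuousOn (fun t => tangentMk E (y t) (v t)) s) {x : M}
    (hx : ∀ t ∈ s, y t ∈ (chartAt E x).source) :
    ContinuousOn (fun t => modelDeriv E E (extChartAt 𝓘(ℝ, E) x) (y t) (v t)) s := by
  have h1 := (trivializationAt E (TangentSpace 𝓘(ℝ, E)) x).continuousOn
  have h2 : ContinuousOn (fun t =>
      (trivializationAt E (TangentSpace 𝓘(ℝ, E)) x (tangentMk E (y t) (v t))).2) s := by
    refine continuous_snd.comp_continuousOn (h1.comp hv fun t ht => ?_)
    rw [Bundle.Trivialization.mem_source]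
    have := hx t ht
    simpa [tangentMk] using this
  exact h2.congr fun t ht => (trivializationAt_tangentMk (hx t ht) (v t)).symm

theorem HasVelocityAt.hasDerivAt_extChartAt {y : ℝ → M} {t : ℝ} {v : E}
    (h : HasVelocityAt E y t v) {x : M} (hx : y t ∈ (chartAt E x).source) :
    HasDerivAt (fun s => extChartAt 𝓘(ℝ, E) x (y s))
      (modelDeriv E E (extChartAt 𝓘(ℝ, E) x) (y t) v) t :=
  hasVelocityAt_iff_hasDerivAt.1 (h.map (mdifferentiableAt_extChartAt hx))

/-- A curve with continuous velocity is `C¹`. -/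
theorem contMDiffOn_one_of_hasVelocityAt {y : ℝ → M} {v : ℝ → E} {s : Set ℝ} (hs : IsOpen s)
    (hy : ∀ t ∈ s, HasVelocityAt E y t (v t))
    (hv : ContinuousOn (fun t => tangentMk E (y t) (v t)) s) :
    ContMDiffOn 𝓘(ℝ, ℝ) 𝓘(ℝ, E) 1 y s := by
  intro t₀ ht₀
  refine ContMDiffAt.contMDiffWithinAt (contMDiffAt_iff_target.2 ⟨(hy t₀ ht₀).continuousAt, ?_⟩)
  rw [contMDiffAt_iff_contDiffAt, contDiffAt_one_iff]
  have hc : ContinuousOn y s := fun t ht => (hy t ht).continuousAt.continuousWithinAt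
  have ho : IsOpen (s ∩ y ⁻¹' (chartAt E (y t₀)).source) :=
    hc.isOpen_inter_preimage hs (chartAt E (y t₀)).open_source
  refine ⟨fun t => ContinuousLinearMap.toSpanSingleton ℝ
    (modelDeriv E E (extChartAt 𝓘(ℝ, E) (y t₀)) (y t) (v t)), _,
    ho.mem_nhds ⟨ht₀, mem_chart_source E (y t₀)⟩, ?_, fun t ht => ?_⟩
  · exact (ContinuousLinearMap.toSpanSingletonCLE (𝕜 := ℝ) (E := E)).continuous.comp_continuousOn
      (continuousOn_modelDeriv_extChartAt (hv.mono Set.inter_subset_left) fun t ht => ht.2)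
  · exact ((hy t ht.1).hasDerivAt_extChartAt ht.2).hasFDerivAt

/-- The coordinates of the velocity of a `C¹` curve are continuous. -/
theorem ContMDiffOn.continuousAt_velocity {y : ℝ → M} {v : ℝ → E} {s : Set ℝ} (hs : IsOpen s)
    (hy : ∀ t ∈ s, HasVelocityAt E y t (v t)) (h : ContMDiffOn 𝓘(ℝ, ℝ) 𝓘(ℝ, E) 1 y s) {t₀ : ℝ}
    (ht₀ : t₀ ∈ s) :
    ContinuousAt (fun t => modelDeriv E E (extChartAt 𝓘(ℝ, E) (y t₀)) (y t) (v t)) t₀ := by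
  have h1 := (contMDiffAt_iff_target.1 (h.contMDiffAt (hs.mem_nhds ht₀))).2
  rw [contMDiffAt_iff_contDiffAt] at h1
  have h2 : ContinuousAt (deriv (extChartAt 𝓘(ℝ, E) (y t₀) ∘ y)) t₀ :=
    (h1.continuousAt_fderiv one_ne_zero).clm_apply continuousAt_const
  refine h2.congr ?_
  filter_upwards [hs.mem_nhds ht₀, (hy t₀ ht₀).continuousAt.eventually_mem
    (chart_source_mem_nhds E (y t₀))] with t ht hty
  exact ((hy t ht).hasDerivAt_extChartAt hty).deriv

/-- In a chart, a functional `ξ` that equals `1` on `Y` at `t₀` recovers `f` near `t₀` as the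
quotient of two continuous functions. -/
theorem continuousOn_velocity_factor {y : ℝ → M} {f : ℝ → ℝ} {Y : M → E} {s : Set ℝ}
    (hs : IsOpen s) (hy : ∀ t ∈ s, HasVelocityAt E y t (f t • Y (y t)))
    (h : ContMDiffOn 𝓘(ℝ, ℝ) 𝓘(ℝ, E) 1 y s) (hY : Continuous (fun m => tangentMk E m (Y m)))
    (hY0 : ∀ t ∈ s, Y (y t) ≠ 0) : ContinuousOn f s := by
  intro t₀ ht₀
  refine ContinuousAt.continuousWithinAt ?_
  set e := extChartAt 𝓘(ℝ, E) (y t₀)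
  have h1 := h.continuousAt_velocity hs hy ht₀
  have h2 : ContinuousAt (fun t => modelDeriv E E e (y t) (Y (y t))) t₀ := by
    have h3 : ContinuousAt (fun m => modelDeriv E E e m (Y m)) (y t₀) :=
      (continuousOn_modelDeriv_extChartAt (y := fun m => m) (s := (chartAt E (y t₀)).source)
        hY.continuousOn fun t ht => ht).continuousAt (chart_source_mem_nhds E (y t₀))
    exact ContinuousAt.comp (f := y) h3 (hy t₀ ht₀).continuousAt
  have h0 : modelDeriv E E e (y t₀) (Y (y t₀)) ≠ 0 := by
    intro h0
    exact hY0 t₀ ht₀ (modelDeriv_extChartAt_injective (mem_extChartAt_source (y t₀))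
      (h0.trans (map_zero _).symm))
  obtain ⟨ξ, hξ⟩ := SeparatingDual.exists_eq_one (R := ℝ) h0
  have h4 := ξ.continuous.continuousAt.comp h1
  have h5 := ξ.continuous.continuousAt.comp h2
  have h6 : ContinuousAt (fun t => ξ (modelDeriv E E e (y t) (f t • Y (y t))) /
      ξ (modelDeriv E E e (y t) (Y (y t)))) t₀ := h4.div h5 (by simp [hξ])
  refine h6.congr ?_
  have h7 : ∀ᶠ t in 𝓝 t₀, ξ (modelDeriv E E e (y t) (Y (y t))) ≠ 0 :=
    h5.eventually_ne (by simp [hξ])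
  filter_upwards [h7] with t ht
  simp [ht]

end ManifoldCurves

/-! ### The reduced line field -/

section Reduction

variable {E : Type*} [NormedAddCommGroup E] [NormedSpace ℝ E] [FiniteDimensional ℝ E]
  {M : Type*} [TopologicalSpace M] [ChartedSpace E M] [IsManifold 𝓘(ℝ, E) ∞ M] [T2Space M]
  {E' : Type*} [NormedAddCommGroup E'] [NormedSpace ℝ E'] [FiniteDimensional ℝ E']
  {C : Type*} [TopologicalSpace C] [ChartedSpace E' C] [IsManifold 𝓘(ℝ, E') ∞ C]
  {D : M → E} {φ : ℝ → M → M} {Ω : SymplecticForm E M} {H : M → ℝ} {Λ : ℝ} {π : M → C}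

variable (E') in
/-- A Hamiltonian system with a complete scaling symmetry acting freely and properly, together with
the quotient by its flow. -/
structure IsScalingReduction (Ω : SymplecticForm E M) (H : M → ℝ) (D : M → E) (φ : ℝ → M → M)
    (Λ : ℝ) (π : M → C) : Prop where
  dim : Module.finrank ℝ E = Module.finrank ℝ E' + 1
  contMDiff_hamiltonian : ContMDiff 𝓘(ℝ, E) 𝓘(ℝ, ℝ) ∞ H
  contMDiff_generator : ContMDiff 𝓘(ℝ, E) 𝓘(ℝ, E).tangent ∞ (fun m => tangentMk E m (D m))
  flow : IsGlobalFlow D φ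
  freeProper : IsFreeProper φ
  scaling : IsScalingSymmetry Ω H φ Λ
  quotient : IsQuotientByFlow E E' φ π

namespace IsScalingReduction

variable (R : IsScalingReduction E' Ω H D φ Λ π)
include R

theorem generator_ne_zero (m : M) : D m ≠ 0 :=
  R.flow.generator_ne_zero R.contMDiff_generator R.freeProper m

theorem mdifferentiable_hamiltonian : MDifferentiable 𝓘(ℝ, E) 𝓘(ℝ, ℝ) H :=
  R.contMDiff_hamiltonian.mdifferentiable (by simp)

theorem hamiltonianField_flow (t : ℝ) (m : M) :
    Ω.hamiltonian H (φ t m) = Real.exp ((Λ - 1) * t) • modelDeriv E E (φ t) m (Ω.hamiltonian H m) := by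
  rw [R.scaling.hamiltonianField_flow R.flow R.mdifferentiable_hamiltonian, smul_smul,
    ← Real.exp_add]
  have : (Λ - 1) * t + (1 - Λ) * t = 0 := by ring
  rw [this, Real.exp_zero, one_smul]

theorem modelDeriv_hamiltonianField_flow (t : ℝ) (m : M) :
    modelDeriv E E' π (φ t m) (Ω.hamiltonian H (φ t m)) =
      Real.exp ((Λ - 1) * t) • modelDeriv E E' π m (Ω.hamiltonian H m) := by
  rw [R.hamiltonianField_flow, map_smul, R.quotient.modelDeriv_flow R.flow]

theorem modelDeriv_eq_zero_iff {m : M} {u : E} :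
    modelDeriv E E' π m u = 0 ↔ ∃ a : ℝ, u = a • D m := by
  constructor
  · exact R.quotient.exists_eq_smul R.dim R.flow m (R.generator_ne_zero m)
  · rintro ⟨a, rfl⟩
    rw [map_smul, R.quotient.modelDeriv_generator R.flow, smul_zero]

/-- This is independence of the point of the fibre: at `φ t m` the projected field is only
multiplied by `e^{(Λ-1)t}`. -/
theorem tangentMk_mem_reducedLineField_iff (m : M) (w : E') :
    tangentMk E' (π m) w ∈ reducedLineField E' Ω H π ↔
      ∃ a : ℝ, a • modelDeriv E E' π m (Ω.hamiltonian H m) = w := by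
  constructor
  · rintro ⟨⟨m', u⟩, hu, hw⟩
    obtain ⟨a, rfl⟩ : ∃ a : ℝ, a • Ω.hamiltonian H m' = u := Submodule.mem_span_singleton.1 hu
    obtain ⟨h1, h2⟩ := tangentMk_eq_iff.1
      ((tangentMap_tangentMk π m' (a • Ω.hamiltonian H m')).symm.trans hw)
    obtain ⟨t, rfl⟩ := (R.quotient.fibre m m').1 h1.symm
    refine ⟨a * Real.exp ((Λ - 1) * t), ?_⟩
    rw [← h2, map_smul, R.modelDeriv_hamiltonianField_flow, smul_smul]
  · rintro ⟨a, rfl⟩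
    refine ⟨tangentMk E m (a • Ω.hamiltonian H m), Submodule.mem_span_singleton.2 ⟨a, rfl⟩, ?_⟩
    rw [tangentMap_tangentMk, map_smul]

theorem mem_modelFibre_reducedLineField_iff {m : M} {c : C} (hc : π m = c) (w : E') :
    w ∈ modelFibre E' (reducedLineField E' Ω H π) c ↔
      ∃ a : ℝ, a • modelDeriv E E' π m (Ω.hamiltonian H m) = w := by
  subst hc
  exact R.tangentMk_mem_reducedLineField_iff m w

theorem modelFibre_reducedLineField (m : M) :
    modelFibre E' (reducedLineField E' Ω H π) (π m) =
      modelDeriv E E' π m '' (Submodule.span ℝ {Ω.hamiltonian H m} : Set E) := by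
  ext w
  rw [R.mem_modelFibre_reducedLineField_iff rfl]
  constructor
  · rintro ⟨a, rfl⟩
    exact ⟨a • Ω.hamiltonian H m, Submodule.mem_span_singleton.2 ⟨a, rfl⟩, map_smul _ _ _⟩
  · rintro ⟨u, hu, rfl⟩
    obtain ⟨a, rfl⟩ := Submodule.mem_span_singleton.1 hu
    exact ⟨a, (map_smul _ _ _).symm⟩

theorem modelFibre_reducedLineField_eq_zero_iff {m : M} {c : C} (hc : π m = c) :
    modelFibre E' (reducedLineField E' Ω H π) c = {0} ↔
      modelDeriv E E' π m (Ω.hamiltonian H m) = 0 := by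
  constructor
  · intro h
    have h1 : modelDeriv E E' π m (Ω.hamiltonian H m) ∈
        modelFibre E' (reducedLineField E' Ω H π) c :=
      (R.mem_modelFibre_reducedLineField_iff hc _).2 ⟨1, one_smul _ _⟩
    rw [h] at h1
    exact h1
  · intro h
    ext w
    rw [R.mem_modelFibre_reducedLineField_iff hc, h]
    simp [eq_comm]

theorem contMDiff_pushforward_section {σ : C → M} (hσ : ContMDiff 𝓘(ℝ, E') 𝓘(ℝ, E) ∞ σ)
    (hπσ : ∀ c, π (σ c) = c) :
    ContMDiff 𝓘(ℝ, E') 𝓘(ℝ, E').tangent ∞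
      (fun c => tangentMk E' c (modelDeriv E E' π (σ c) (Ω.hamiltonian H (σ c)))) := by
  have : IsManifold 𝓘(ℝ, E) 1 M := IsManifold.of_le (n := ∞) (by simp)
  have : IsManifold 𝓘(ℝ, E') 1 C := IsManifold.of_le (n := ∞) (by simp)
  have h1 : ContMDiff 𝓘(ℝ, E).tangent 𝓘(ℝ, E').tangent ∞ (tangentMap 𝓘(ℝ, E) 𝓘(ℝ, E') π) :=
    R.quotient.contMDiff.contMDiff_tangentMap (by simp)
  have h2 := h1.comp ((Ω.contMDiff_hamiltonian R.contMDiff_hamiltonian).comp hσ)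
  convert h2 using 1
  funext c
  exact tangentMk_eq_iff.2 ⟨(hπσ c).symm, rfl⟩

theorem exists_section [T2Space C] [SigmaCompactSpace C] :
    ∃ (σ : C → M) (h : M → ℝ), ContMDiff 𝓘(ℝ, E') 𝓘(ℝ, E) ∞ σ ∧ ContMDiff 𝓘(ℝ, E) 𝓘(ℝ, ℝ) ∞ h ∧
      (∀ c, π (σ c) = c) ∧ (∀ c, h (σ c) = 0) ∧ (∀ m t, h (φ t m) = h m + t) ∧
      ∀ m, φ (h m) (σ (π m)) = m :=
  R.quotient.exists_section R.dim R.flow R.freeProper R.generator_ne_zero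

/-- The reduced line field is smooth. -/
theorem isSmoothLineField_reducedLineField [IsManifold 𝓘(ℝ, E') 1 C] [T2Space C]
    [SigmaCompactSpace C] : IsSmoothLineField (reducedLineField E' Ω H π) := by
  obtain ⟨σ, h, hσ, -, hπσ, -⟩ := R.exists_section
  intro c
  refine ⟨Set.univ, isOpen_univ, Set.mem_univ c,
    fun c => modelDeriv E E' π (σ c) (Ω.hamiltonian H (σ c)),
    (R.contMDiff_pushforward_section hσ hπσ).contMDiffOn, fun c' _ => ?_⟩
  apply Set.ext
  intro w
  exact (R.mem_modelFibre_reducedLineField_iff (hπσ c') w).trans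
    Submodule.mem_span_singleton.symm

/-- Where the Hamiltonian vector field is a multiple of the generator of the scaling symmetry, it
has an integral curve in the orbit of the symmetry. -/
theorem exists_integralCurve_in_orbit {m : M} (h0 : modelDeriv E E' π m (Ω.hamiltonian H m) = 0)
    (r₀ : ℝ) : ∃ u : ℝ → ℝ, u r₀ = 0 ∧ ∃ ε > 0, ∀ r ∈ Set.Ioo (r₀ - ε) (r₀ + ε),
      HasVelocityAt E (fun r => φ (u r) m) r (Ω.hamiltonian H (φ (u r) m)) := by
  obtain ⟨b, hb⟩ := R.modelDeriv_eq_zero_iff.1 h0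
  -- With `X_H(m) = b D(m)`, scaling gives `X_H = b e^{(Λ-1)u} D` at `φ_u m`. A trajectory in the
  -- orbit is therefore a solution of `u' = b e^{(Λ-1)u}`, which is only claimed to exist for a
  -- short time.
  have hsm : ContDiffAt ℝ 1 (fun u : ℝ => b * Real.exp ((Λ - 1) * u)) 0 := by fun_prop
  obtain ⟨u, hu0, ε, hε, hu⟩ :=
    hsm.exists_forall_mem_closedBall_exists_eq_forall_mem_Ioo_hasDerivAt₀ r₀
  refine ⟨u, hu0, ε, hε, fun r hr => ?_⟩
  have h1 := R.flow.hasVelocityAt_comp (hu r hr) (hasVelocityAt_const m r)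
  rw [map_zero, add_zero] at h1
  rw [R.hamiltonianField_flow, hb, map_smul, R.flow.modelDeriv_generator, smul_smul, mul_comm]
  exact h1

/-- A trajectory through a point where the reduced line field vanishes stays in one fibre. -/
theorem map_eq_of_modelDeriv_eq_zero [T2Space C] {s : Set ℝ} (hs : IsOpen s) (hs' : IsPreconnected s)
    {x : ℝ → M} (hx : ∀ r ∈ s, HasVelocityAt E x r (Ω.hamiltonian H (x r))) {r₀ : ℝ} (hr₀ : r₀ ∈ s)
    (h0 : modelDeriv E E' π (x r₀) (Ω.hamiltonian H (x r₀)) = 0) :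
    ∀ r ∈ s, π (x r) = π (x r₀) := by
  have : IsManifold 𝓘(ℝ, E) 1 M := IsManifold.of_le (n := ∞) (by simp)
  have hcont : ContinuousOn (fun r => π (x r)) s := fun r hr =>
    (R.quotient.contMDiff.continuous.continuousAt.comp (hx r hr).continuousAt).continuousWithinAt
  -- The vanishing of `dπ X_H` holds along the whole fibre. At any time spent in the fibre,
  -- uniqueness therefore identifies `x` with a trajectory inside the orbit.
  have hlocal : ∀ r₁ ∈ s, π (x r₁) = π (x r₀) → ∀ᶠ r in 𝓝 r₁, π (x r) = π (x r₀) := by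
    intro r₁ hr₁ he
    obtain ⟨t, ht⟩ := (R.quotient.fibre (x r₀) (x r₁)).1 he.symm
    have h1 : modelDeriv E E' π (x r₁) (Ω.hamiltonian H (x r₁)) = 0 := by
      rw [← ht, R.modelDeriv_hamiltonianField_flow, h0, smul_zero]
    obtain ⟨u, hu0, ε, hε, hu⟩ := R.exists_integralCurve_in_orbit h1 r₁
    have h2 : IsMIntegralCurveAt (I := 𝓘(ℝ, E)) x (Ω.hamiltonian H) r₁ := by
      filter_upwards [hs.mem_nhds hr₁] with r hr
      exact hx r hr
    have h3 : IsMIntegralCurveAt (I := 𝓘(ℝ, E)) (fun r => φ (u r) (x r₁)) (Ω.hamiltonian H) r₁ := by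
      filter_upwards [Ioo_mem_nhds (a := r₁ - ε) (b := r₁ + ε) (by linarith) (by linarith)]
        with r hr
      exact hu r hr
    have h4 := isMIntegralCurveAt_eventuallyEq_of_contMDiffAt_boundaryless (I := 𝓘(ℝ, E))
      (((Ω.contMDiff_hamiltonian R.contMDiff_hamiltonian).of_le (by simp)) (x r₁)) h2 h3
      (by simp [hu0, R.flow.zero])
    filter_upwards [h4] with r hr
    rw [hr, R.quotient.map_flow, he]
  by_contra! hne
  obtain ⟨r₁, hr₁, hne⟩ := hne
  -- Where `π ∘ x` is locally equal to `π (x r₀)`, and where it differs from that value: two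
  -- disjoint open sets covering the preconnected set `s`.
  let A : Set ℝ := {r | ∀ᶠ r' in 𝓝 r, π (x r') = π (x r₀)}
  have hA : IsOpen A := isOpen_setOfPred_eventually_nhds
  let B : Set ℝ := s ∩ (fun r => π (x r)) ⁻¹' {π (x r₀)}ᶜ
  have hB : IsOpen B := hcont.isOpen_inter_preimage hs isClosed_singleton.isOpen_compl
  obtain ⟨r, -, hrA, hrB⟩ := hs' A B hA hB
    (fun r hr => by
      by_cases h : π (x r) = π (x r₀)
      · exact Or.inl (hlocal r hr h)
      · exact Or.inr ⟨hr, h⟩)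
    ⟨r₀, hr₀, hlocal r₀ hr₀ rfl⟩ ⟨r₁, hr₁, hr₁, hne⟩
  exact hrB.2 (Filter.Eventually.self_of_nhds (p := fun r => π (x r) = π (x r₀)) hrA)

end IsScalingReduction

end Reduction

/-! ### Integral curves of the line field and trajectories -/

section Trajectories

variable {E : Type*} [NormedAddCommGroup E] [NormedSpace ℝ E] [FiniteDimensional ℝ E]
  {M : Type*} [TopologicalSpace M] [ChartedSpace E M] [IsManifold 𝓘(ℝ, E) ∞ M] [T2Space M]
  {E' : Type*} [NormedAddCommGroup E'] [NormedSpace ℝ E'] [FiniteDimensional ℝ E']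
  {C : Type*} [TopologicalSpace C] [ChartedSpace E' C] [IsManifold 𝓘(ℝ, E') ∞ C] [T2Space C]
  {D : M → E} {φ : ℝ → M → M} {Ω : SymplecticForm E M} {H : M → ℝ} {Λ : ℝ} {π : M → C}

namespace IsScalingReduction

/-- Projections of trajectories are integral curves of the reduced line field. -/
theorem isLineFieldIntegralCurve_of_trajectory (R : IsScalingReduction E' Ω H D φ Λ π)
    {s : Set ℝ} (hs : IsOpen s) (hs' : s.OrdConnected) {γ : ℝ → C} {τ : ℝ → ℝ} {x : ℝ → M}
    (hτ : ContDiffOn ℝ 1 τ s) (hτ0 : ∀ t ∈ s, deriv τ t ≠ 0)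
    (hx : IsMIntegralCurveOn (I := 𝓘(ℝ, E)) x (Ω.hamiltonian H) (τ '' s))
    (hγ : ∀ t ∈ s, γ t = π (x (τ t))) :
    IsLineFieldIntegralCurve (reducedLineField E' Ω H π) γ s := by
  have : IsManifold 𝓘(ℝ, E) 1 M := IsManifold.of_le (n := ∞) (by simp)
  have : IsManifold 𝓘(ℝ, E') 1 C := IsManifold.of_le (n := ∞) (by simp)
  have ho := isOpen_image_of_deriv_ne_zero hs hτ hτ0
  have hv : ∀ r ∈ τ '' s, HasVelocityAt E x r (Ω.hamiltonian H (x r)) := fun r hr =>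
    HasMFDerivWithinAt.hasMFDerivAt (hx r hr) (ho.mem_nhds hr)
  have hxc : ContinuousOn x (τ '' s) := fun r hr => (hv r hr).continuousAt.continuousWithinAt
  have hx1 : ContMDiffOn 𝓘(ℝ, ℝ) 𝓘(ℝ, E) 1 x (τ '' s) :=
    contMDiffOn_one_of_hasVelocityAt ho hv
      ((Ω.contMDiff_hamiltonian R.contMDiff_hamiltonian).continuous.comp_continuousOn hxc)
  have hγ1 : ContMDiffOn 𝓘(ℝ, ℝ) 𝓘(ℝ, E') 1 γ s := by
    have h1 : ContMDiffOn 𝓘(ℝ, ℝ) 𝓘(ℝ, E) 1 (fun t => x (τ t)) s :=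
      hx1.comp hτ.contMDiffOn (Set.subset_preimage_image τ s)
    exact ((R.quotient.contMDiff.of_le (by simp)).comp_contMDiffOn h1).congr hγ
  have hγv : ∀ t ∈ s, HasVelocityAt E' γ t
      (deriv τ t • modelDeriv E E' π (x (τ t)) (Ω.hamiltonian H (x (τ t)))) := by
    intro t ht
    have hd : HasDerivAt τ (deriv τ t) t :=
      ((hτ.contDiffAt (hs.mem_nhds ht)).differentiableAt one_ne_zero).hasDerivAt
    have h1 := ((hv _ (Set.mem_image_of_mem τ ht)).comp hd).map (R.quotient.mdifferentiableAt _)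
    rw [map_smul] at h1
    exact h1.congr (Filter.eventually_of_mem (hs.mem_nhds ht) hγ)
  have hpre : IsPreconnected (τ '' s) := hs'.isPreconnected.image τ hτ.continuousOn
  refine ⟨hγ1, fun t ht => ?_, ?_⟩
  · exact (R.mem_modelFibre_reducedLineField_iff (hγ t ht).symm _).2
      ⟨deriv τ t, (hγv t ht).mfderiv_one.symm⟩
  -- A single zero of the projected field along the trajectory forces the constant case; otherwise
  -- `γ'` is a product of non-zero factors.
  · by_cases h0 : ∃ t₀ ∈ s, modelDeriv E E' π (x (τ t₀)) (Ω.hamiltonian H (x (τ t₀))) = 0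
    · obtain ⟨t₀, ht₀, h0⟩ := h0
      refine Or.inr ⟨π (x (τ t₀)), (R.modelFibre_reducedLineField_eq_zero_iff rfl).2 h0,
        fun t ht => ?_⟩
      rw [hγ t ht]
      exact R.map_eq_of_modelDeriv_eq_zero ho hpre hv (Set.mem_image_of_mem τ ht₀) h0 _
        (Set.mem_image_of_mem τ ht)
    · push Not at h0
      refine Or.inl fun t ht h => ?_
      have h1 : modelDeriv ℝ E' γ t 1 = 0 := h
      rw [(hγv t ht).mfderiv_one] at h1
      exact (smul_ne_zero (hτ0 t ht) (h0 t ht)) h1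

/-- The trajectory inside the orbit over `c` is available only for a short time, while `s` may be
unbounded. The freedom of reparametrization squeezes `s` into that short interval. -/
theorem exists_trajectory_of_const (R : IsScalingReduction E' Ω H D φ Λ π) (c : C)
    (hc : modelFibre E' (reducedLineField E' Ω H π) c = {0}) (s : Set ℝ) :
    ∃ (τ : ℝ → ℝ) (x : ℝ → M), ContDiffOn ℝ 1 τ s ∧ (∀ t ∈ s, deriv τ t ≠ 0) ∧
      IsMIntegralCurveOn (I := 𝓘(ℝ, E)) x (Ω.hamiltonian H) (τ '' s) ∧
      ∀ t ∈ s, c = π (x (τ t)) := by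
  obtain ⟨m, rfl⟩ := R.quotient.surjective c
  have h0 := (R.modelFibre_reducedLineField_eq_zero_iff rfl).1 hc
  obtain ⟨u, -, ε, hε, hu⟩ := R.exists_integralCurve_in_orbit h0 0
  have hd : ∀ t, HasDerivAt (fun t => ε / 2 * Real.arctan t) (ε / 2 * (1 / (1 + t ^ 2))) t :=
    fun t => (Real.hasDerivAt_arctan t).const_mul _
  -- The values stay in `(-ε, ε)` because `π / 4 < 1`.
  refine ⟨fun t => ε / 2 * Real.arctan t, fun r => φ (u r) m,
    (contDiff_const.mul Real.contDiff_arctan).contDiffOn, fun t _ => ?_, ?_, fun t _ => ?_⟩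
  · rw [(hd t).deriv]
    positivity
  · rintro _ ⟨t, -, rfl⟩
    refine HasMFDerivAt.hasMFDerivWithinAt (hu _ ?_)
    have h1 := Real.arctan_lt_pi_div_two t
    have h2 := Real.neg_pi_div_two_lt_arctan t
    have h3 := Real.pi_lt_four
    constructor
    · nlinarith
    · nlinarith
  · rw [R.quotient.map_flow]

/-- The lift `y = φ_A (σ ∘ γ)` has velocity `(A' - f g) D + f e^{(1-Λ)A} X_H`, where `γ' = f Y` and
`g = dh(X_H)` along `σ`. Taking `A' = f g` leaves a nowhere vanishing multiple `F` of `X_H`, which a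
change of time with `τ' = F` removes. -/
theorem exists_trajectory_of_immersed [SigmaCompactSpace C]
    (R : IsScalingReduction E' Ω H D φ Λ π)
    {s : Set ℝ} (hs : IsOpen s) (hs' : s.OrdConnected) {γ : ℝ → C}
    (hγ : ContMDiffOn 𝓘(ℝ, ℝ) 𝓘(ℝ, E') 1 γ s)
    (hγℓ : ∀ t ∈ s, modelDeriv ℝ E' γ t 1 ∈ modelFibre E' (reducedLineField E' Ω H π) (γ t))
    (hγ0 : ∀ t ∈ s, modelDeriv ℝ E' γ t 1 ≠ 0) :
    ∃ (τ : ℝ → ℝ) (x : ℝ → M), ContDiffOn ℝ 1 τ s ∧ (∀ t ∈ s, deriv τ t ≠ 0) ∧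
      IsMIntegralCurveOn (I := 𝓘(ℝ, E)) x (Ω.hamiltonian H) (τ '' s) ∧
      ∀ t ∈ s, γ t = π (x (τ t)) := by
  have : IsManifold 𝓘(ℝ, E) 1 M := IsManifold.of_le (n := ∞) (by simp)
  have : IsManifold 𝓘(ℝ, E') 1 C := IsManifold.of_le (n := ∞) (by simp)
  obtain ⟨σ, h, hσ, hh, hπσ, hhσ, hequi, -⟩ := R.exists_section
  set X : M → E := Ω.hamiltonian H with hX
  have hXs := Ω.contMDiff_hamiltonian R.contMDiff_hamiltonian
  set Y : C → E' := fun c => modelDeriv E E' π (σ c) (X (σ c)) with hY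
  have hσd : ∀ c, MDifferentiableAt 𝓘(ℝ, E') 𝓘(ℝ, E) σ c := hσ.mdifferentiable (by simp)
  have hhd : ∀ m, MDifferentiableAt 𝓘(ℝ, E) 𝓘(ℝ, ℝ) h m := hh.mdifferentiable (by simp)
  let g : C → ℝ := fun c => modelDeriv E ℝ h (σ c) (X (σ c))
  have hg : Continuous g := by
    have h1 : ContMDiff 𝓘(ℝ, E).tangent 𝓘(ℝ, ℝ).tangent ∞ (tangentMap 𝓘(ℝ, E) 𝓘(ℝ, ℝ) h) :=
      hh.contMDiff_tangentMap (by simp)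
    have h2 : Continuous (fun c => tangentMk ℝ (h (σ c)) (g c)) :=
      (h1.comp (hXs.comp hσ)).continuous
    have h3 := continuousOn_modelDeriv_extChartAt (y := fun c => h (σ c)) (v := g) (x := (0 : ℝ))
      h2.continuousOn (s := Set.univ) (fun t _ => by rw [chartAt_self_eq]; exact Set.mem_univ _)
    rw [continuousOn_univ] at h3
    refine h3.congr fun c => ?_
    rw [extChartAt_model_space_eq_id]
    exact modelDeriv_id _ _
  have hhD : ∀ m, modelDeriv E ℝ h m (D m) = 1 := by
    intro m
    have h1 := (R.flow.hasVelocityAt 0 m).map (hhd (φ 0 m))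
    have h2 : HasDerivAt (fun t => h (φ t m)) 1 0 := by
      simp_rw [hequi m]
      simpa using (hasDerivAt_id (0 : ℝ)).const_add (h m)
    have h3 := h1.unique (hasVelocityAt_iff_hasDerivAt.2 h2)
    rwa [R.flow.zero] at h3
  have hhσ' : ∀ c w, modelDeriv E ℝ h (σ c) (modelDeriv E' E σ c w) = 0 := by
    intro c w
    rw [← modelDeriv_comp _ _ _ (hhd _) (hσd c)]
    have h1 : (fun c => h (σ c)) = fun _ => 0 := funext hhσ
    rw [h1]
    exact congrArg (fun L : E' →L[ℝ] ℝ => L w)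
      (mfderiv_const (I := 𝓘(ℝ, E')) (I' := 𝓘(ℝ, ℝ)) (x := c) (c := (0 : ℝ)))
  have hπσ' : ∀ c w, modelDeriv E E' π (σ c) (modelDeriv E' E σ c w) = w := by
    intro c w
    rw [← modelDeriv_comp _ _ _ (R.quotient.mdifferentiableAt _) (hσd c)]
    have h1 : (fun c => π (σ c)) = fun c => c := funext hπσ
    rw [h1, modelDeriv_id]
  -- Both `X_H` and `dσ Y` project to `Y`, so they differ by a multiple of `D`. The coefficient is
  -- read off by `dh`, which is `1` on `D` and `0` on the image of `dσ`.
  have hdec : ∀ c, modelDeriv E' E σ c (Y c) = X (σ c) - g c • D (σ c) := by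
    intro c
    obtain ⟨a, ha⟩ := R.modelDeriv_eq_zero_iff.1
      (show modelDeriv E E' π (σ c) (X (σ c) - modelDeriv E' E σ c (Y c)) = 0 by
        rw [map_sub, hπσ', sub_self])
    have h1 := congrArg (modelDeriv E ℝ h (σ c)) ha
    rw [map_sub, map_smul, hhσ', hhD, sub_zero, smul_eq_mul, mul_one] at h1
    have h2 : g c = a := h1
    rw [h2, ← ha]
    abel
  have hγv : ∀ t ∈ s, HasVelocityAt E' γ t (modelDeriv ℝ E' γ t 1) := fun t ht =>
    ((hγ.contMDiffAt (hs.mem_nhds ht)).mdifferentiableAt one_ne_zero).hasVelocityAt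
  have hex : ∀ t, ∃ a : ℝ, t ∈ s → a • Y (γ t) = modelDeriv ℝ E' γ t 1 := by
    intro t
    by_cases ht : t ∈ s
    · obtain ⟨a, ha⟩ := (R.mem_modelFibre_reducedLineField_iff (hπσ (γ t)) _).1 (hγℓ t ht)
      exact ⟨a, fun _ => ha⟩
    · exact ⟨0, fun h => absurd h ht⟩
  choose f hf using hex
  have hf0 : ∀ t ∈ s, f t ≠ 0 := fun t ht h0 => hγ0 t ht (by rw [← hf t ht, h0, zero_smul])
  have hY0 : ∀ t ∈ s, Y (γ t) ≠ 0 := fun t ht h0 => hγ0 t ht (by rw [← hf t ht, h0, smul_zero])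
  have hγv' : ∀ t ∈ s, HasVelocityAt E' γ t (f t • Y (γ t)) := fun t ht => by
    rw [hf t ht]; exact hγv t ht
  have hfc : ContinuousOn f s := continuousOn_velocity_factor hs hγv' hγ
    (R.contMDiff_pushforward_section hσ hπσ).continuous hY0
  -- First quadrature: `A` cancels the `D`-component of the lift.
  obtain ⟨A, hA⟩ := (hfc.mul (hg.comp_continuousOn hγ.continuousOn)).exists_hasDerivAt hs hs'
  have hA : ∀ t ∈ s, HasDerivAt A (f t * g (γ t)) t := hA
  have hAc : ContinuousOn A s := fun t ht => (hA t ht).continuousAt.continuousWithinAt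
  let F : ℝ → ℝ := fun t => f t * Real.exp ((1 - Λ) * A t)
  have hF : ContinuousOn F s := hfc.mul (Real.continuous_exp.comp_continuousOn
    (continuousOn_const.mul hAc))
  have hF0 : ∀ t ∈ s, F t ≠ 0 := fun t ht => mul_ne_zero (hf0 t ht) (Real.exp_ne_zero _)
  let y : ℝ → M := fun t => φ (A t) (σ (γ t))
  have hy : ∀ t ∈ s, HasVelocityAt E y t (F t • X (y t)) := by
    intro t ht
    have h1 := R.flow.hasVelocityAt_comp (hA t ht) ((hγv' t ht).map (hσd (γ t)))
    convert h1 using 1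
    rw [map_smul, hdec, map_smul, map_sub, map_smul, R.flow.modelDeriv_generator,
      R.scaling.hamiltonianField_flow R.flow R.mdifferentiable_hamiltonian, smul_sub, smul_smul,
      smul_smul]
    simp only [F, y, hX]
    abel
  -- Second quadrature: `τ` is the time of the Hamiltonian flow along the lift.
  obtain ⟨τ, hτ⟩ := hF.exists_hasDerivAt hs hs'
  obtain ⟨ρ, hρ⟩ := exists_leftInverse_of_hasDerivAt hs hs' hτ hF hF0
  refine ⟨τ, fun r => y (ρ r), contDiffOn_one_of_hasDerivAt hs hτ hF, fun t ht => ?_, ?_,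
    fun t ht => ?_⟩
  · rw [(hτ t ht).deriv]
    exact hF0 t ht
  · rintro _ ⟨t, ht, rfl⟩
    have h1 : HasVelocityAt E y (ρ (τ t)) (F t • X (y t)) := by
      rw [(hρ t ht).1]; exact hy t ht
    have h2 := h1.comp (hρ t ht).2
    rw [smul_smul, inv_mul_cancel₀ (hF0 t ht), one_smul] at h2
    have h3 : X (y t) = X (y (ρ (τ t))) := by rw [(hρ t ht).1]
    rw [h3] at h2
    exact HasMFDerivAt.hasMFDerivWithinAt h2
  · simp only [y]
    rw [(hρ t ht).1, R.quotient.map_flow, hπσ]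

/-- The integral curves of the reduced line field are the reparametrized projections of the
trajectories. -/
theorem isLineFieldIntegralCurve_iff [SigmaCompactSpace C]
    (R : IsScalingReduction E' Ω H D φ Λ π)
    {s : Set ℝ} (hs : IsOpen s) (hs' : s.OrdConnected) (γ : ℝ → C) :
    IsLineFieldIntegralCurve (reducedLineField E' Ω H π) γ s ↔
      ∃ (τ : ℝ → ℝ) (x : ℝ → M), ContDiffOn ℝ 1 τ s ∧ (∀ t ∈ s, deriv τ t ≠ 0) ∧
        IsMIntegralCurveOn (I := 𝓘(ℝ, E)) x (Ω.hamiltonian H) (τ '' s) ∧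
        ∀ t ∈ s, γ t = π (x (τ t)) := by
  constructor
  · rintro ⟨h1, h2, h3 | ⟨c, hc, h3⟩⟩
    · exact R.exists_trajectory_of_immersed hs hs' h1 h2 h3
    · obtain ⟨τ, x, hτ, hτ0, hx, hcx⟩ := R.exists_trajectory_of_const c hc s
      exact ⟨τ, x, hτ, hτ0, hx, fun t ht => (h3 t ht).trans (hcx t ht)⟩
  · rintro ⟨τ, x, hτ, hτ0, hx, hγ⟩
    exact R.isLineFieldIntegralCurve_of_trajectory hs hs' hτ hτ0 hx hγ

end IsScalingReduction

end Trajectories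

/-! ### Curves in a regular level set -/

section LevelCurve

variable {E : Type*} [NormedAddCommGroup E] [NormedSpace ℝ E]
  {M : Type*} [TopologicalSpace M] [ChartedSpace E M] [IsManifold 𝓘(ℝ, E) ∞ M]

/-- Every vector in the kernel of the differential of a function at a regular point is the velocity
of a curve in the level set. -/
theorem exists_curve_in_level {H : M → ℝ} (hH : ContMDiff 𝓘(ℝ, E) 𝓘(ℝ, ℝ) ∞ H) {m : M}
    (h0 : modelDeriv E ℝ H m ≠ 0) {u : E} (hu : modelDeriv E ℝ H m u = 0) :
    ∃ y : ℝ → M, ContMDiffAt 𝓘(ℝ, ℝ) 𝓘(ℝ, E) ∞ y 0 ∧ y 0 = m ∧ HasVelocityAt E y 0 u ∧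
      ∀ᶠ t in 𝓝 (0 : ℝ), H (y t) = H m := by
  obtain ⟨w, hw⟩ : ∃ w, modelDeriv E ℝ H m w = 1 := by
    obtain ⟨v, hv⟩ : ∃ v, modelDeriv E ℝ H m v ≠ 0 := by
      by_contra! h
      exact h0 (ContinuousLinearMap.ext h)
    exact ⟨(modelDeriv E ℝ H m v)⁻¹ • v, by simp [hv]⟩
  set e := extChartAt 𝓘(ℝ, E) m
  -- The implicit function theorem is applied on a surface through `m` spanned by `u` and by a
  -- transverse direction `w` with `dH(w) = 1`.
  let L : ℝ × ℝ →L[ℝ] E :=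
    (ContinuousLinearMap.fst ℝ ℝ ℝ).smulRight (modelDeriv E E e m u) +
      (ContinuousLinearMap.snd ℝ ℝ ℝ).smulRight (modelDeriv E E e m w)
  let q : ℝ × ℝ → E := fun p => e m + L p
  have hq : ContMDiff 𝓘(ℝ, ℝ × ℝ) 𝓘(ℝ, E) ∞ q :=
    (contDiff_const.add L.contDiff).contMDiff
  have hq0 : q 0 = e m := by simp [q]
  let P : ℝ × ℝ → M := fun p => e.symm (q p)
  have hP0 : P 0 = m := by
    simp only [P, hq0]
    exact extChartAt_to_inv m
  have hes : ContMDiffAt 𝓘(ℝ, E) 𝓘(ℝ, E) ∞ e.symm (e m) :=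
    contMDiffAt_extChartAt_symm (mem_extChartAt_target m)
  have hP : ContMDiffAt 𝓘(ℝ, ℝ × ℝ) 𝓘(ℝ, E) ∞ P 0 :=
    ContMDiffAt.comp (0 : ℝ × ℝ) (by rw [hq0]; exact hes) hq.contMDiffAt
  have hPd : ∀ p, modelDeriv (ℝ × ℝ) E P 0 p = p.1 • u + p.2 • w := by
    intro p
    have h1 := modelDeriv_comp e.symm q 0 (by rw [hq0]; exact hes.mdifferentiableAt (by simp))
      (hq.mdifferentiable (by simp) 0) p
    have h2 : modelDeriv (ℝ × ℝ) E q 0 = L := by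
      have : modelDeriv (ℝ × ℝ) E q 0 = fderiv ℝ q 0 := mfderiv_eq_fderiv
      rw [this]
      exact (L.hasFDerivAt.const_add (e m)).fderiv
    have h3 : L p = modelDeriv E E e m (p.1 • u + p.2 • w) := by simp [L]
    rw [h2, hq0, h3, modelDeriv_extChartAt_symm_modelDeriv (mem_extChartAt_source m)] at h1
    exact h1
  -- Since `dH(u) = 0` and `dH(w) = 1`, this map has identity derivative at `0`. The curve sought is
  -- the image under `P ∘ θ` of the line on which the second coordinate is `H m`.
  let K : ℝ × ℝ → ℝ × ℝ := fun p => (p.1, H (P p))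
  have hHP : ContMDiffAt 𝓘(ℝ, ℝ × ℝ) 𝓘(ℝ, ℝ) ∞ (fun p => H (P p)) 0 :=
    ContMDiffAt.comp (0 : ℝ × ℝ) hH.contMDiffAt hP
  have hK : ContDiffAt ℝ ∞ K 0 := contDiffAt_fst.prodMk hHP.contDiffAt
  have hKd : ∀ p, modelDeriv (ℝ × ℝ) (ℝ × ℝ) K 0 p = p := by
    intro p
    have h1 : modelDeriv (ℝ × ℝ) (ℝ × ℝ) K 0 = fderiv ℝ K 0 := mfderiv_eq_fderiv
    have h2 : HasFDerivAt K ((ContinuousLinearMap.fst ℝ ℝ ℝ).prod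
        (fderiv ℝ (fun p => H (P p)) 0)) 0 :=
      hasFDerivAt_fst.prodMk (hHP.contDiffAt.differentiableAt (by simp)).hasFDerivAt
    have h3 : modelDeriv (ℝ × ℝ) ℝ (fun p => H (P p)) 0 = fderiv ℝ (fun p => H (P p)) 0 :=
      mfderiv_eq_fderiv
    have h4 := modelDeriv_comp H P 0 (hH.mdifferentiable (by simp) _)
      (hP.mdifferentiableAt (by simp)) p
    rw [h1, h2.fderiv, ← h3, ContinuousLinearMap.prod_apply, h4, hPd, hP0]
    simp [hu, hw]
  obtain ⟨θ, hθ, hθ0, hKθ⟩ := (hK.contMDiffAt (n := ∞)).exists_rightInverse (by simp)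
    (show Function.Bijective (modelDeriv (ℝ × ℝ) (ℝ × ℝ) K 0) by
      have : (modelDeriv (ℝ × ℝ) (ℝ × ℝ) K 0 : ℝ × ℝ → ℝ × ℝ) = id := funext hKd
      rw [this]; exact Function.bijective_id)
  have hK0 : K 0 = (0, H m) := by simp [K, hP0]
  have hθd : ∀ p, modelDeriv (ℝ × ℝ) (ℝ × ℝ) θ (K 0) p = p := by
    intro p
    have h1 := modelDeriv_comp K θ (K 0) (by
      rw [hθ0]; exact (hK.contMDiffAt (n := ∞)).mdifferentiableAt (by simp))
      (hθ.mdifferentiableAt (by simp)) p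
    have h2 : (fun x => K (θ x)) =ᶠ[𝓝 (K 0)] fun x => x := hKθ
    rw [modelDeriv_congr h2, modelDeriv_id, hθ0, hKd] at h1
    exact h1.symm
  let ι : ℝ → ℝ × ℝ := fun t => (t, H m)
  have hι : ContMDiff 𝓘(ℝ, ℝ) 𝓘(ℝ, ℝ × ℝ) ∞ ι := (contDiff_id.prodMk contDiff_const).contMDiff
  have hι0 : ι 0 = K 0 := hK0.symm
  have hιv : HasVelocityAt (ℝ × ℝ) ι 0 (1, 0) := hasVelocityAt_iff_hasDerivAt.2
    ((hasDerivAt_id (0 : ℝ)).prodMk (hasDerivAt_const (0 : ℝ) (H m)))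
  rw [← hι0] at hθ hθ0 hθd hKθ
  have hθι : ContMDiffAt 𝓘(ℝ, ℝ) 𝓘(ℝ, ℝ × ℝ) ∞ (fun t => θ (ι t)) 0 :=
    ContMDiffAt.comp (0 : ℝ) hθ hι.contMDiffAt
  have hPθ : ContMDiffAt 𝓘(ℝ, ℝ) 𝓘(ℝ, E) ∞ (fun t => P (θ (ι t))) 0 :=
    ContMDiffAt.comp (I' := 𝓘(ℝ, ℝ × ℝ)) (g := P) (f := fun t => θ (ι t)) (0 : ℝ)
      (by rw [hθ0]; exact hP) hθι
  refine ⟨fun t => P (θ (ι t)), hPθ, ?_, ?_, ?_⟩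
  · exact (congrArg P hθ0).trans hP0
  · have h1 := (hιv.map (hθ.mdifferentiableAt (by simp))).map (f := P)
      (by rw [hθ0]; exact hP.mdifferentiableAt (by simp))
    rw [hθd, hθ0, hPd] at h1
    simpa using h1
  · filter_upwards [hι.continuous.continuousAt.eventually hKθ] with t ht
    exact congrArg Prod.snd ht

end LevelCurve

/-! ### The contact distribution and the zero level -/

section Contact

variable {E : Type*} [NormedAddCommGroup E] [NormedSpace ℝ E] [FiniteDimensional ℝ E]
  {M : Type*} [TopologicalSpace M] [ChartedSpace E M] [IsManifold 𝓘(ℝ, E) ∞ M] [T2Space M]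
  {E' : Type*} [NormedAddCommGroup E'] [NormedSpace ℝ E'] [FiniteDimensional ℝ E']
  {C : Type*} [TopologicalSpace C] [ChartedSpace E' C] [IsManifold 𝓘(ℝ, E') ∞ C]
  {D : M → E} {φ : ℝ → M → M} {Ω : SymplecticForm E M} {H : M → ℝ} {Λ : ℝ} {π : M → C}

namespace IsScalingReduction

variable (R : IsScalingReduction E' Ω H D φ Λ π)
include R

/-- The conformal symplectic structure on the contact distribution is well defined. -/
theorem exists_conformal_factor {m m' : M} (hm : π m = π m') :
    ∃ a : ℝ, 0 < a ∧ ∀ u v u' v' : E,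
      Ω.pairing m (D m) u = 0 → Ω.pairing m (D m) v = 0 →
      Ω.pairing m' (D m') u' = 0 → Ω.pairing m' (D m') v' = 0 →
      tangentMap 𝓘(ℝ, E) 𝓘(ℝ, E') π (tangentMk E m u) =
        tangentMap 𝓘(ℝ, E) 𝓘(ℝ, E') π (tangentMk E m' u') →
      tangentMap 𝓘(ℝ, E) 𝓘(ℝ, E') π (tangentMk E m v) =
        tangentMap 𝓘(ℝ, E) 𝓘(ℝ, E') π (tangentMk E m' v') →
      Ω.pairing m' u' v' = a * Ω.pairing m u v := by
  obtain ⟨t, rfl⟩ := (R.quotient.fibre m m').1 hm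
  -- Lifts at `φ t m` are determined up to multiples of `D`, and these do not affect the pairing of
  -- vectors of `ker λ`. What remains is the factor `e^t` of the flow.
  have key : ∀ u u' : E, tangentMap 𝓘(ℝ, E) 𝓘(ℝ, E') π (tangentMk E m u) =
        tangentMap 𝓘(ℝ, E) 𝓘(ℝ, E') π (tangentMk E (φ t m) u') →
      ∃ b : ℝ, u' = modelDeriv E E (φ t) m u + b • D (φ t m) := by
    intro u u' h
    rw [tangentMap_tangentMk, tangentMap_tangentMk, tangentMk_eq_iff] at h
    obtain ⟨b, hb⟩ := R.modelDeriv_eq_zero_iff.1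
      (show modelDeriv E E' π (φ t m) (u' - modelDeriv E E (φ t) m u) = 0 by
        rw [map_sub, R.quotient.modelDeriv_flow R.flow, h.2, sub_self])
    exact ⟨b, by rw [← hb]; abel⟩
  refine ⟨Real.exp t, Real.exp_pos t, fun u v u' v' hu hv hu' hv' huu hvv => ?_⟩
  obtain ⟨b, rfl⟩ := key u u' huu
  obtain ⟨c, rfl⟩ := key v v' hvv
  have h1 : Ω.pairing (φ t m) (modelDeriv E E (φ t) m u) (D (φ t m)) = 0 := by
    rw [Ω.pairing_swap]
    simpa [Ω.pairing_self] using hu'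
  have h2 : Ω.pairing (φ t m) (D (φ t m)) (modelDeriv E E (φ t) m v) = 0 := by
    simpa [Ω.pairing_self] using hv'
  simp only [map_add, map_smul, LinearMap.add_apply, LinearMap.smul_apply, h1, h2, Ω.pairing_self,
    R.scaling.pairing_flow R.flow, smul_zero, add_zero]

/-- Any one point of the fibre suffices, since `dφ_t` preserves `D` and rescales `Ω`, hence
preserves `ker λ`. -/
theorem mem_contactDistribution_iff (m : M) (w : E') :
    tangentMk E' (π m) w ∈ contactDistribution Ω D π ↔
      ∃ u : E, Ω.pairing m (D m) u = 0 ∧ modelDeriv E E' π m u = w := by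
  constructor
  · rintro ⟨p, hu', hw⟩
    obtain ⟨m', u', rfl⟩ : ∃ (m' : M) (u' : E), p = tangentMk E m' u' := ⟨p.1, p.2, rfl⟩
    obtain ⟨h1, h2⟩ := tangentMk_eq_iff.1 ((tangentMap_tangentMk π m' u').symm.trans hw)
    obtain ⟨t, rfl⟩ := (R.quotient.fibre m m').1 h1.symm
    obtain ⟨u, rfl⟩ := R.flow.exists_modelDeriv_eq t m u'
    have h3 : Ω.pairing (φ t m) (D (φ t m)) (modelDeriv E E (φ t) m u) = 0 := hu'
    rw [← R.flow.modelDeriv_generator, R.scaling.pairing_flow R.flow] at h3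
    rw [R.quotient.modelDeriv_flow R.flow] at h2
    exact ⟨u, (mul_eq_zero.1 h3).resolve_left (Real.exp_ne_zero t), h2⟩
  · rintro ⟨u, hu, rfl⟩
    exact ⟨tangentMk E m u, hu, rfl⟩

/-- The existential choice of lifts in `ConformalOrthogonal` is harmless: other lifts change the
pairing by a positive factor only. -/
theorem conformalOrthogonal_iff {m : M} {u v : E} (hu : Ω.pairing m (D m) u = 0)
    (hv : Ω.pairing m (D m) v = 0) :
    ConformalOrthogonal Ω D π (tangentMk E' (π m) (modelDeriv E E' π m u))
      (tangentMk E' (π m) (modelDeriv E E' π m v)) ↔ Ω.pairing m u v = 0 := by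
  constructor
  · rintro ⟨m', u', v', hu', hv', hpu, hpv, h0⟩
    have hm : π m' = π m :=
      congrArg (fun p : TangentBundle 𝓘(ℝ, E') C => p.1) hpu
    obtain ⟨a, -, ha⟩ := R.exists_conformal_factor hm
    have h1 : Ω.pairing m' u' v' = 0 := h0
    rw [ha u' v' u v hu' hv' hu hv hpu hpv, h1, mul_zero]
  · intro h
    exact ⟨m, u, v, hu, hv, rfl, rfl, h⟩

/-- As `H ∘ φ_t = e^{Λt} H`, the zero level is the full preimage of `Σ₀`. A curve in `Σ₀` therefore
lifts through a local section to a curve on which `H = 0`. Conversely, regularity of `m` provides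
curves in the level, and these are projected. -/
theorem mem_tangentVectors_zeroLevelImage_iff {m : M} (hm : H m = 0)
    (hdH : modelDeriv E ℝ H m ≠ 0) (w : E') :
    tangentMk E' (π m) w ∈ tangentVectors E' (zeroLevelImage H π) ↔
      ∃ u : E, modelDeriv E ℝ H m u = 0 ∧ modelDeriv E E' π m u = w := by
  constructor
  · rintro ⟨γ, hγ, hγH, hw⟩
    obtain ⟨h1, h2⟩ : π m = γ 0 ∧ w = modelDeriv ℝ E' γ 0 1 := tangentMk_eq_iff.1 hw
    obtain ⟨U, σ, hU, hmU, hσ, hσm, hπσ⟩ := R.quotient.submersion.exists_localSection m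
    have hσd : MDifferentiableAt 𝓘(ℝ, E') 𝓘(ℝ, E) σ (γ 0) := by
      rw [← h1]
      exact (hσ.contMDiffAt (hU.mem_nhds hmU)).mdifferentiableAt (by simp)
    have hγv := (hγ.mdifferentiableAt one_ne_zero).hasVelocityAt
    have h3 := (hγv.map hσd).map (R.mdifferentiable_hamiltonian _)
    have h4 : (fun t => H (σ (γ t))) =ᶠ[𝓝 0] fun _ => 0 := by
      filter_upwards [hγH, hγ.continuousAt.eventually_mem (hU.mem_nhds (h1 ▸ hmU))] with t ht htU
      obtain ⟨m', hm', hπm'⟩ := ht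
      obtain ⟨r, hr⟩ := (R.quotient.fibre m' (σ (γ t))).1 (by rw [hπσ _ htU, hπm'])
      rw [← hr, R.scaling.hamiltonian_flow R.flow]
      exact mul_eq_zero_of_right _ hm'
    have h5 := h3.unique ((hasVelocityAt_const (E := ℝ) (0 : ℝ) 0).congr h4)
    refine ⟨modelDeriv E' E σ (π m) w, ?_, ?_⟩
    · rw [← h1, hσm, ← h2] at h5
      exact h5
    · have h6 := modelDeriv_comp π σ (π m) (R.quotient.mdifferentiableAt _) (h1 ▸ hσd) w
      have h7 : (fun c => π (σ c)) =ᶠ[𝓝 (π m)] fun c => c :=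
        Filter.eventually_of_mem (hU.mem_nhds hmU) hπσ
      rw [modelDeriv_congr h7, modelDeriv_id, hσm] at h6
      exact h6.symm
  · rintro ⟨u, hu, rfl⟩
    obtain ⟨y, hy, hy0, hyv, hyH⟩ := exists_curve_in_level R.contMDiff_hamiltonian hdH hu
    refine ⟨fun t => π (y t), ?_, ?_, ?_⟩
    · exact (R.quotient.contMDiff.contMDiffAt.comp (0 : ℝ) hy).of_le (by simp)
    · filter_upwards [hyH] with t ht
      exact ⟨y t, ht.trans hm, rfl⟩
    · have h1 := hyv.map (R.quotient.mdifferentiableAt _)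
      refine (tangentMk_eq_iff (u := modelDeriv E E' π m u)
        (v := modelDeriv ℝ E' (fun t => π (y t)) 0 1)).2 ⟨congrArg π hy0.symm, ?_⟩
      rw [h1.mfderiv_one, hy0]

/-- This is `Ω(D, X_H) = dH(D) = ΛH`. -/
theorem pairing_generator_hamiltonianField {m : M} (hm : H m = 0) :
    Ω.pairing m (D m) (Ω.hamiltonian H m) = 0 := by
  rw [Ω.pairing_swap, Ω.pairing_hamiltonian,
    R.scaling.modelDeriv_generator R.flow R.mdifferentiable_hamiltonian, hm]
  simp

omit R in
-- The functional `Ω(u, ·)` vanishes on the common kernel of `Ω(D, ·)` and `Ω(X_H, ·) = -dH`, so it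
-- is a combination of the two. Non-degeneracy transfers this to the vectors.
theorem exists_eq_add_of_pairing {m : M} {u : E}
    (h : ∀ v, Ω.pairing m (D m) v = 0 → modelDeriv E ℝ H m v = 0 → Ω.pairing m u v = 0) :
    ∃ a b : ℝ, u = a • D m + b • Ω.hamiltonian H m := by
  have h1 : Ω.pairing m u ∈ Submodule.span ℝ
      (Set.range ![Ω.pairing m (D m), Ω.pairing m (Ω.hamiltonian H m)]) := by
    refine mem_span_of_iInf_ker_le_ker fun v hv => ?_
    simp only [Submodule.mem_iInf, LinearMap.mem_ker] at hv
    have hv0 := hv 0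
    have hv1 := hv 1
    simp only [Matrix.cons_val_zero, Matrix.cons_val_one] at hv0 hv1
    rw [Ω.pairing_hamiltonian, neg_eq_zero] at hv1
    exact h v hv0 hv1
  rw [Matrix.range_cons, Matrix.range_cons, Matrix.range_empty, Set.union_empty,
    Set.singleton_union, Submodule.mem_span_pair] at h1
  obtain ⟨a, b, hab⟩ := h1
  refine ⟨a, b, sub_eq_zero.1 (Ω.eq_zero_of_pairing m _ fun v => ?_)⟩
  rw [map_sub, map_add, map_smul, map_smul, hab, sub_self, LinearMap.zero_apply]

theorem mem_tangentVectors_inter_contactDistribution_iff {m : M} (hm : H m = 0)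
    (hdH : modelDeriv E ℝ H m ≠ 0) (w : E') :
    tangentMk E' (π m) w ∈
        tangentVectors E' (zeroLevelImage H π) ∩ contactDistribution Ω D π ↔
      ∃ v : E, Ω.pairing m (D m) v = 0 ∧ modelDeriv E ℝ H m v = 0 ∧ modelDeriv E E' π m v = w := by
  rw [Set.mem_inter_iff, R.mem_tangentVectors_zeroLevelImage_iff hm hdH,
    R.mem_contactDistribution_iff]
  constructor
  -- The two conditions come with separate lifts, which differ by a multiple of `D`. Since `Ω(D, D)
  -- = 0`, the lift in `ker dH` also lies in `ker λ`.
  · rintro ⟨⟨v, hv, rfl⟩, u, hu, huv⟩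
    obtain ⟨b, hb⟩ := R.modelDeriv_eq_zero_iff.1
      (show modelDeriv E E' π m (v - u) = 0 by rw [map_sub, huv, sub_self])
    refine ⟨v, ?_, hv, rfl⟩
    rw [← sub_add_cancel v u, map_add, hb, hu, map_smul, Ω.pairing_self]
    simp
  · rintro ⟨v, hv, hvH, rfl⟩
    exact ⟨⟨v, hvH, rfl⟩, v, hv, rfl⟩

/-- At a regular point of the zero level, the reduced line field is the orthogonal complement of the
intersection of the tangent space of the level with the contact distribution. -/
theorem mem_conformalPerp_iff {m : M} (hm : H m = 0) (hdH : modelDeriv E ℝ H m ≠ 0) (w : E') :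
    tangentMk E' (π m) w ∈ conformalPerp Ω D π
        (tangentVectors E' (zeroLevelImage H π) ∩ contactDistribution Ω D π) ↔
      ∃ a : ℝ, a • modelDeriv E E' π m (Ω.hamiltonian H m) = w := by
  constructor
  · rintro ⟨h1, h2⟩
    obtain ⟨u, hu, rfl⟩ := (R.mem_contactDistribution_iff m w).1 h1
    obtain ⟨a, b, hab⟩ := exists_eq_add_of_pairing (Ω := Ω) (H := H) (D := D) (m := m) (u := u)
      fun v hv hvH => (R.conformalOrthogonal_iff hu hv).1 (h2 _
        ((R.mem_tangentVectors_inter_contactDistribution_iff hm hdH _).2 ⟨v, hv, hvH, rfl⟩) rfl)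
    refine ⟨b, ?_⟩
    rw [hab, map_add, map_smul, map_smul, R.quotient.modelDeriv_generator R.flow, smul_zero,
      zero_add]
  · rintro ⟨a, rfl⟩
    have hX := R.pairing_generator_hamiltonianField hm
    have haX : Ω.pairing m (D m) (a • Ω.hamiltonian H m) = 0 := by rw [map_smul, hX, smul_zero]
    rw [← map_smul]
    refine ⟨(R.mem_contactDistribution_iff m _).2 ⟨_, haX, rfl⟩, ?_⟩
    rintro ⟨c, w'⟩ hq hqc
    obtain rfl : c = π m := hqc
    obtain ⟨v, hv, hvH, rfl⟩ :=
      (R.mem_tangentVectors_inter_contactDistribution_iff hm hdH w').1 hq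
    refine (R.conformalOrthogonal_iff haX hv).2 ?_
    rw [map_smul, LinearMap.smul_apply, Ω.pairing_hamiltonian, hvH]
    simp

theorem modelFibre_reducedLineField_eq_conformalPerp {m : M} (hm : H m = 0)
    (hdH : modelDeriv E ℝ H m ≠ 0) :
    modelFibre E' (reducedLineField E' Ω H π) (π m) = modelFibre E' (conformalPerp Ω D π
        (tangentVectors E' (zeroLevelImage H π) ∩ contactDistribution Ω D π)) (π m) := by
  ext w
  rw [R.mem_modelFibre_reducedLineField_iff rfl]
  exact (R.mem_conformalPerp_iff hm hdH w).symm

/-- The lift `X_H` lies in `ker λ` because `H m = 0`, and in `ker dH` because `Ω(X_H, X_H) = 0`. -/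
theorem modelFibre_conformalPerp_subset {m : M} (hm : H m = 0)
    (hdH : modelDeriv E ℝ H m ≠ 0) :
    modelFibre E' (conformalPerp Ω D π
        (tangentVectors E' (zeroLevelImage H π) ∩ contactDistribution Ω D π)) (π m) ⊆
      modelFibre E' (tangentVectors E' (zeroLevelImage H π) ∩ contactDistribution Ω D π) (π m) := by
  intro w hw
  obtain ⟨a, rfl⟩ := (R.mem_conformalPerp_iff hm hdH w).1 hw
  refine (R.mem_tangentVectors_inter_contactDistribution_iff hm hdH _).2
    ⟨a • Ω.hamiltonian H m, ?_, ?_, map_smul _ _ _⟩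
  · rw [map_smul, R.pairing_generator_hamiltonianField hm, smul_zero]
  · have h1 := Ω.pairing_hamiltonian H m (Ω.hamiltonian H m)
    rw [Ω.pairing_self] at h1
    rw [map_smul, neg_eq_zero.1 h1.symm, smul_zero]

end IsScalingReduction

end Contact

end

theorem mainTheorem8 (n : ℕ)
    {M : Type*} [TopologicalSpace M] [ChartedSpace (EuclideanSpace ℝ (Fin (2 * n + 2))) M]
    [IsManifold (𝓡 (2 * n + 2)) ∞ M] [T2Space M] [SecondCountableTopology M]
    {C : Type*} [TopologicalSpace C] [ChartedSpace (EuclideanSpace ℝ (Fin (2 * n + 1))) C]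
    [IsManifold (𝓡 (2 * n + 1)) ∞ C] [T2Space C] [SecondCountableTopology C]
    (Ω : SymplecticForm (EuclideanSpace ℝ (Fin (2 * n + 2))) M)
    (H : M → ℝ) (hH : ContMDiff (𝓡 (2 * n + 2)) 𝓘(ℝ, ℝ) ∞ H)
    (D : ∀ m : M, TangentSpace (𝓡 (2 * n + 2)) m)
    (hD : ContMDiff (𝓡 (2 * n + 2)) (𝓡 (2 * n + 2)).tangent ∞
      (fun m => (⟨m, D m⟩ : TangentBundle (𝓡 (2 * n + 2)) M)))
    (φ : ℝ → M → M) (hφ : IsGlobalFlow D φ) (hfree : IsFreeProper φ)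
    (Λ : ℝ) (hscale : IsScalingSymmetry Ω H φ Λ)
    (π : M → C)
    (hπ : IsQuotientByFlow (EuclideanSpace ℝ (Fin (2 * n + 2)))
      (EuclideanSpace ℝ (Fin (2 * n + 1))) φ π) :
    -- `ℓ = π_* span (X_H)` is a smooth line field on `C`
    IsSmoothLineField (reducedLineField (EuclideanSpace ℝ (Fin (2 * n + 1))) Ω H π) ∧
    -- it is determined by `span (X_H)` at any single point of the fibre
    (∀ m : M, tangentFibre (reducedLineField (EuclideanSpace ℝ (Fin (2 * n + 1))) Ω H π) (π m) =
      mfderiv (𝓡 (2 * n + 2)) (𝓡 (2 * n + 1)) π m ''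
        (Submodule.span ℝ {hamiltonianVectorField Ω H m} :
          Set (TangentSpace (𝓡 (2 * n + 2)) m))) ∧
    -- and it vanishes exactly where `X_H` is a multiple of `D`
    (∀ m : M, tangentFibre (reducedLineField (EuclideanSpace ℝ (Fin (2 * n + 1))) Ω H π) (π m) = {0} ↔
      hamiltonianVectorField Ω H m ∈ Submodule.span ℝ {D m}) ∧
    -- the integral curves of `ℓ` are the (reparametrized) projections of the trajectories of `X_H`
    (∀ (s : Set ℝ), IsOpen s → s.OrdConnected → ∀ γ : ℝ → C,
      IsLineFieldIntegralCurve (reducedLineField (EuclideanSpace ℝ (Fin (2 * n + 1))) Ω H π) γ s ↔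
        ∃ (τ : ℝ → ℝ) (x : ℝ → M), ContDiffOn ℝ 1 τ s ∧ (∀ t ∈ s, deriv τ t ≠ 0) ∧
          IsMIntegralCurveOn (I := 𝓡 (2 * n + 2)) x (hamiltonianVectorField Ω H) (τ '' s) ∧
          ∀ t ∈ s, γ t = π (x (τ t))) ∧
    -- the conformal symplectic structure on the contact distribution is well defined
    (∀ m m' : M, π m = π m' → ∃ a : ℝ, 0 < a ∧
      ∀ (u v : TangentSpace (𝓡 (2 * n + 2)) m) (u' v' : TangentSpace (𝓡 (2 * n + 2)) m'),
        (⟨m, u⟩ : TangentBundle (𝓡 (2 * n + 2)) M) ∈ liouvilleKernel Ω D →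
        (⟨m, v⟩ : TangentBundle (𝓡 (2 * n + 2)) M) ∈ liouvilleKernel Ω D →
        (⟨m', u'⟩ : TangentBundle (𝓡 (2 * n + 2)) M) ∈ liouvilleKernel Ω D →
        (⟨m', v'⟩ : TangentBundle (𝓡 (2 * n + 2)) M) ∈ liouvilleKernel Ω D →
        tangentMap (𝓡 (2 * n + 2)) (𝓡 (2 * n + 1)) π ⟨m, u⟩ =
          tangentMap (𝓡 (2 * n + 2)) (𝓡 (2 * n + 1)) π ⟨m', u'⟩ →
        tangentMap (𝓡 (2 * n + 2)) (𝓡 (2 * n + 1)) π ⟨m, v⟩ =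
          tangentMap (𝓡 (2 * n + 2)) (𝓡 (2 * n + 1)) π ⟨m', v'⟩ →
        Ω.form m' ![u', v'] = a * Ω.form m ![u, v]) ∧
    -- description of `ℓ` at the (regular) points of `Σ₀ = π (H = 0)`
    (∀ m : M, H m = 0 → mfderiv (𝓡 (2 * n + 2)) 𝓘(ℝ, ℝ) H m ≠ 0 →
      tangentFibre (reducedLineField (EuclideanSpace ℝ (Fin (2 * n + 1))) Ω H π) (π m) =
        tangentFibre (conformalPerp Ω D π
          (tangentVectors (EuclideanSpace ℝ (Fin (2 * n + 1))) (zeroLevelImage H π) ∩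
            contactDistribution Ω D π)) (π m) ∧
      tangentFibre (conformalPerp Ω D π
          (tangentVectors (EuclideanSpace ℝ (Fin (2 * n + 1))) (zeroLevelImage H π) ∩
            contactDistribution Ω D π)) (π m) ⊆
        tangentFibre
          (tangentVectors (EuclideanSpace ℝ (Fin (2 * n + 1))) (zeroLevelImage H π) ∩
            contactDistribution Ω D π) (π m)) := by
  -- Together with second countability this makes `C` σ-compact, as the partition of unity requires.
  have : LocallyCompactSpace C :=
    ChartedSpace.locallyCompactSpace (EuclideanSpace ℝ (Fin (2 * n + 1))) C
  have R : IsScalingReduction (EuclideanSpace ℝ (Fin (2 * n + 1))) Ω H D φ Λ π :=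
    { dim := by simp
      contMDiff_hamiltonian := hH
      contMDiff_generator := hD
      flow := hφ
      freeProper := hfree
      scaling := hscale
      quotient := hπ }
  refine ⟨R.isSmoothLineField_reducedLineField, R.modelFibre_reducedLineField, fun m => ?_,
    fun s hs hs' γ => R.isLineFieldIntegralCurve_iff hs hs' γ,
    fun m m' h => R.exists_conformal_factor h,
    fun m hm hdH => ⟨R.modelFibre_reducedLineField_eq_conformalPerp hm hdH,
      R.modelFibre_conformalPerp_subset hm hdH⟩⟩
  refine (R.modelFibre_reducedLineField_eq_zero_iff rfl).trans (R.modelDeriv_eq_zero_iff.trans ?_)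
  refine Iff.trans ?_ Submodule.mem_span_singleton.symm
  exact exists_congr fun a => eq_comm
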